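/- Conventions. All monoidal categories are strict symmetric monoidal (SMC), with unit $I$ and symmetry $\sigma$, and an i.o.o. functor is a strict symmetric monoidal functor that is the identity on objects. A $\dagger$-SMC is an SMC with an involutive contravariant i.o.o. functor $(\cdot)^\dagger$. An SMC is compact closed if every object $A$ has an object $A^*$ and morphisms $\mathrm{cup}\colon A\otimes A^*\to I$, $\mathrm{cap}\colon I\to A^*\otimes A$ satisfying the two snake equations; a $\dagger$-SMC is $\dagger$-compact if these can moreover be chosen with $\mathrm{cup}^\dagger=\sigma_{A^*,A}\circ\mathrm{cap}$. A morphism $f\colon A\to B$ of a $\dagger$-SMC $\mathbf C$ is an isometry if $f^\dagger\circ f=1_A$; $\mathbf C_{iso}$ is the sub-SMC of isometries. The category $\mathbf{FHilb}$ has the objects $\mathbb C^n$ ($n\in\mathbb N$), linear maps as morphisms, the usual tensor product with $\mathbb C^m\otimes\mathbb C^n=\mathbb C^{mn}$, and the adjoint as dagger. Discard construction. For an SMC $\mathbf D$, the affine completion $\mathbf D^{!}$ is the SMC obtained by freely adding to $\mathbf D$ a morphism $!_A\colon A\to I$ for every object $A$ and making $I$ terminal (so $!_B\circ f={!_A}$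 for all $f\colon A\to B$). For a $\dagger$-SMC $\mathbf C$, the category $\mathbf C^{⏚}$ is the pushout of SMCs of the i.o.o. functors $\mathbf C\leftarrow\mathbf C_{iso}\to(\mathbf C_{iso})^{!}$: it has the objects of $\mathbf C$, and its morphisms are formal composites and tensors of morphisms of $\mathbf C$ and of $(\mathbf C_{iso})^{!}$, modulo the laws of SMCs, the equations of both categories, and the identification of the two images of each isometry. Let $\iota\colon\mathbf C\to\mathbf C^{⏚}$ be the canonical functor and let $⏚_A\colon A\to I$ be the image of $!_A$. Relations. For $f\colon A\to B\otimes X$ and $g\colon A\to B\otimes Y$ in a $\dagger$-SMC $\mathbf C$, write $f\sim_{CP}g$ if $$(1_B\otimes f^\dagger)(1_B\otimes\sigma_{X,B})(f\otimes 1_B)=(1_B\otimes g^\dagger)(1_B\otimes\sigma_{Y,B})(g\otimes 1_B)\colon A\otimes B\to B\otimes A,$$ and $f\sim_{iso}g$ if there are an object $Z$ and isometries $u\colon X\to Z$, $v\colon Y\to Z$ with $(1_B\otimes u)\circ f=(1_B\otimes v)\circ g$. Let $\sim_{iso}^+$ be the transitive closure of $\sim_{iso}$, for each fixed $A,B$.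 Environment structures. An environment structure for a $\dagger$-compact category $\mathbf C$ consists of a compact closed SMC $\overline{\mathbf C}$ with the same objects, an i.o.o. functor $\iota\colon\mathbf C\to\overline{\mathbf C}$, and morphisms $⏚_A\colon A\to I$ of $\overline{\mathbf C}$ for every object $A$, such that: (1) $⏚_I=1_I$ and $⏚_A\otimes⏚_B=⏚_{A\otimes B}$; (2) for every $f\colon A\to B$ in $\overline{\mathbf C}$ there are $X$ and $f'\colon A\to B\otimes X$ in $\mathbf C$ with $f=(1_B\otimes⏚_X)\circ\iota(f')$; (3) for all $f\colon A\to B\otimes X$ and $g\colon A\to B\otimes Y$ in $\mathbf C$: $f\sim_{CP}g$ if and only if $(1_B\otimes⏚_X)\circ\iota(f)=(1_B\otimes⏚_Y)\circ\iota(g)$. Proposition. $\mathbf{FHilb}$ is $\dagger$-compact, and $\mathbf{FHilb}^{⏚}$, with its canonical functor $\iota$ and discard maps $⏚_A$, is an environment structure for $\mathbf{FHilb}$. Moreover, on $\mathbf{FHilb}$ the relation $\sim_{iso}$ is transitive, that is, $\sim_{iso}^+\,=\,\sim_{iso}$. -/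

import Mathlib

/-!
Strict symmetric monoidal categories are given over a fixed monoid `O` of objects: the product of
`O` is the tensor of objects and `1 : O` is the tensor unit `I`.  Consequently "the same objects"
and "identity on objects" hold on the nose.  Composition is written in diagrammatic order:
`comp f g` is first `f`, then `g`.
-/

universe u v w

/-- Transport of a morphism along equalities of its domain and codomain. -/
def castHom {O : Type u} (H : O → O → Type v) {A A' B B' : O} (hA : A = A') (hB : B = B')
    (f : H A B) : H A' B' :=
  cast (congrArg₂ H hA hB) f

theorem castHom_map {O : Type u} {H : O → O → Type v} {K : O → O → Type w}
    (φ : ∀ {A B : O}, H A B → K A B) {A A' B B' : O} (hA : A = A') (hB : B = B') (f : H A B) :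
    φ (castHom H hA hB f) = castHom K hA hB (φ f) := by
  subst hA; subst hB; rfl

/-- A strict symmetric monoidal category with monoid of objects `O`. -/
structure StrictSMC (O : Type u) [Monoid O] where
  Hom : O → O → Type v
  id : ∀ A : O, Hom A A
  comp : ∀ {A B C : O}, Hom A B → Hom B C → Hom A C
  tensor : ∀ {A B C D : O}, Hom A B → Hom C D → Hom (A * C) (B * D)
  swap : ∀ A B : O, Hom (A * B) (B * A)
  id_comp : ∀ {A B : O} (f : Hom A B), comp (id A) f = f
  comp_id : ∀ {A B : O} (f : Hom A B), comp f (id B) = f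
  assoc : ∀ {A B C D : O} (f : Hom A B) (g : Hom B C) (h : Hom C D),
    comp (comp f g) h = comp f (comp g h)
  tensor_id : ∀ A B : O, tensor (id A) (id B) = id (A * B)
  tensor_comp : ∀ {A B C A' B' C' : O} (f : Hom A B) (g : Hom B C) (f' : Hom A' B')
    (g' : Hom B' C'), tensor (comp f g) (comp f' g') = comp (tensor f f') (tensor g g')
  tensor_assoc : ∀ {A B C A' B' C' : O} (f : Hom A A') (g : Hom B B') (h : Hom C C'),
    castHom Hom (mul_assoc A B C) (mul_assoc A' B' C') (tensor (tensor f g) h)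
      = tensor f (tensor g h)
  unit_tensor : ∀ {A B : O} (f : Hom A B),
    castHom Hom (one_mul A) (one_mul B) (tensor (id 1) f) = f
  tensor_unit : ∀ {A B : O} (f : Hom A B),
    castHom Hom (mul_one A) (mul_one B) (tensor f (id 1)) = f
  swap_natural : ∀ {A B C D : O} (f : Hom A B) (g : Hom C D),
    comp (tensor f g) (swap B D) = comp (swap A C) (tensor g f)
  swap_unit : ∀ A : O, castHom Hom (mul_one A) (one_mul A) (swap A 1) = id A
  swap_tensor : ∀ A B C : O,
    castHom Hom (mul_assoc A B C).symm (mul_assoc B C A) (swap A (B * C)) =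
      comp (castHom Hom rfl (mul_assoc B A C) (tensor (swap A B) (id C)))
        (tensor (id B) (swap A C))
  swap_swap : ∀ A B : O, comp (swap A B) (swap B A) = id (A * B)

/-- A strict symmetric monoidal functor that is the identity on objects. -/
structure IOOFunctor {O : Type u} [Monoid O] (C : StrictSMC.{u, v} O)
    (D : StrictSMC.{u, w} O) where
  map : ∀ {A B : O}, C.Hom A B → D.Hom A B
  map_id : ∀ A : O, map (C.id A) = D.id A
  map_comp : ∀ {A B E : O} (f : C.Hom A B) (g : C.Hom B E),
    map (C.comp f g) = D.comp (map f) (map g)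
  map_tensor : ∀ {A B A' B' : O} (f : C.Hom A B) (g : C.Hom A' B'),
    map (C.tensor f g) = D.tensor (map f) (map g)
  map_swap : ∀ A B : O, map (C.swap A B) = D.swap A B

/-- A `†`-SMC: a strict SMC with an involutive, contravariant, strict symmetric monoidal functor
that is the identity on objects. -/
structure DaggerSMC (O : Type u) [Monoid O] extends StrictSMC.{u, v} O where
  dagger : ∀ {A B : O}, Hom A B → Hom B A
  dagger_dagger : ∀ {A B : O} (f : Hom A B), dagger (dagger f) = f
  dagger_id : ∀ A : O, dagger (id A) = id A
  dagger_comp : ∀ {A B C : O} (f : Hom A B) (g : Hom B C),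
    dagger (comp f g) = comp (dagger g) (dagger f)
  dagger_tensor : ∀ {A B C D : O} (f : Hom A B) (g : Hom C D),
    dagger (tensor f g) = tensor (dagger f) (dagger g)
  dagger_swap : ∀ A B : O, dagger (swap A B) = swap B A

namespace StrictSMC

variable {O : Type u} [Monoid O]

/-- The two snake equations for `cup : A ⊗ A' → I` and `cap : I → A' ⊗ A`. -/
def IsDuality (C : StrictSMC.{u, v} O) {A A' : O} (cup : C.Hom (A * A') 1)
    (cap : C.Hom 1 (A' * A)) : Prop :=
  C.comp (castHom C.Hom (mul_one A) (mul_assoc A A' A).symm (C.tensor (C.id A) cap))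
      (castHom C.Hom rfl (one_mul A) (C.tensor cup (C.id A))) = C.id A ∧
  C.comp (castHom C.Hom (one_mul A') (mul_assoc A' A A') (C.tensor cap (C.id A')))
      (castHom C.Hom rfl (mul_one A') (C.tensor (C.id A') cup)) = C.id A'

/-- Compact closed: every object has a dual. -/
def IsCompactClosed (C : StrictSMC.{u, v} O) : Prop :=
  ∀ A : O, ∃ (A' : O) (cup : C.Hom (A * A') 1) (cap : C.Hom 1 (A' * A)), C.IsDuality cup cap

end StrictSMC

/-! ### Strict SMCs presented by generators and relations -/

/-- Formal composites and tensors of generators, identities and symmetries. -/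
inductive SMCTerm {O : Type u} [Monoid O] (G : O → O → Type v) : O → O → Type (max u v)
  | gen {A B : O} (g : G A B) : SMCTerm G A B
  | id (A : O) : SMCTerm G A A
  | swap (A B : O) : SMCTerm G (A * B) (B * A)
  | comp {A B C : O} (s : SMCTerm G A B) (t : SMCTerm G B C) : SMCTerm G A C
  | tensor {A B C D : O} (s : SMCTerm G A B) (t : SMCTerm G C D) : SMCTerm G (A * C) (B * D)

/-- The smallest congruence on terms that contains `R` and the laws of strict SMCs. -/
inductive SMCCongr {O : Type u} [Monoid O] {G : O → O → Type v}
    (R : ∀ {A B : O}, SMCTerm G A B → SMCTerm G A B → Prop) :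
    ∀ {A B : O}, SMCTerm G A B → SMCTerm G A B → Prop
  | of {A B : O} {s t : SMCTerm G A B} : R s t → SMCCongr R s t
  | refl {A B : O} (s : SMCTerm G A B) : SMCCongr R s s
  | symm {A B : O} {s t : SMCTerm G A B} : SMCCongr R s t → SMCCongr R t s
  | trans {A B : O} {s t r : SMCTerm G A B} : SMCCongr R s t → SMCCongr R t r → SMCCongr R s r
  | comp_congr {A B C : O} {s s' : SMCTerm G A B} {t t' : SMCTerm G B C} :
      SMCCongr R s s' → SMCCongr R t t' → SMCCongr R (s.comp t) (s'.comp t')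
  | tensor_congr {A B C D : O} {s s' : SMCTerm G A B} {t t' : SMCTerm G C D} :
      SMCCongr R s s' → SMCCongr R t t' → SMCCongr R (s.tensor t) (s'.tensor t')
  | id_comp {A B : O} (f : SMCTerm G A B) : SMCCongr R ((SMCTerm.id A).comp f) f
  | comp_id {A B : O} (f : SMCTerm G A B) : SMCCongr R (f.comp (SMCTerm.id B)) f
  | assoc {A B C D : O} (f : SMCTerm G A B) (g : SMCTerm G B C) (h : SMCTerm G C D) :
      SMCCongr R ((f.comp g).comp h) (f.comp (g.comp h))
  | tensor_id (A B : O) :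
      SMCCongr R ((SMCTerm.id A).tensor (SMCTerm.id B)) (SMCTerm.id (A * B))
  | tensor_comp {A B C A' B' C' : O} (f : SMCTerm G A B) (g : SMCTerm G B C)
      (f' : SMCTerm G A' B') (g' : SMCTerm G B' C') :
      SMCCongr R ((f.comp g).tensor (f'.comp g')) ((f.tensor f').comp (g.tensor g'))
  | tensor_assoc {A B C A' B' C' : O} (f : SMCTerm G A A') (g : SMCTerm G B B')
      (h : SMCTerm G C C') :
      SMCCongr R
        (castHom (SMCTerm G) (mul_assoc A B C) (mul_assoc A' B' C') ((f.tensor g).tensor h))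
        (f.tensor (g.tensor h))
  | unit_tensor {A B : O} (f : SMCTerm G A B) :
      SMCCongr R (castHom (SMCTerm G) (one_mul A) (one_mul B) ((SMCTerm.id 1).tensor f)) f
  | tensor_unit {A B : O} (f : SMCTerm G A B) :
      SMCCongr R (castHom (SMCTerm G) (mul_one A) (mul_one B) (f.tensor (SMCTerm.id 1))) f
  | swap_natural {A B C D : O} (f : SMCTerm G A B) (g : SMCTerm G C D) :
      SMCCongr R ((f.tensor g).comp (SMCTerm.swap B D)) ((SMCTerm.swap A C).comp (g.tensor f))
  | swap_unit (A : O) :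
      SMCCongr R (castHom (SMCTerm G) (mul_one A) (one_mul A) (SMCTerm.swap A 1)) (SMCTerm.id A)
  | swap_tensor (A B C : O) :
      SMCCongr R
        (castHom (SMCTerm G) (mul_assoc A B C).symm (mul_assoc B C A) (SMCTerm.swap A (B * C)))
        ((castHom (SMCTerm G) rfl (mul_assoc B A C)
            ((SMCTerm.swap A B).tensor (SMCTerm.id C))).comp
          ((SMCTerm.id B).tensor (SMCTerm.swap A C)))
  | swap_swap (A B : O) :
      SMCCongr R ((SMCTerm.swap A B).comp (SMCTerm.swap B A)) (SMCTerm.id (A * B))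

/-- The quotient of terms by the generated congruence. -/
def PresentedHom {O : Type u} [Monoid O] {G : O → O → Type v}
    (R : ∀ {A B : O}, SMCTerm G A B → SMCTerm G A B → Prop) (A B : O) : Type (max u v) :=
  Quot (fun s t : SMCTerm G A B => SMCCongr R s t)

/-- The class of a term. -/
def PresentedHom.mk {O : Type u} [Monoid O] {G : O → O → Type v}
    (R : ∀ {A B : O}, SMCTerm G A B → SMCTerm G A B → Prop) {A B : O} (t : SMCTerm G A B) :
    PresentedHom R A B :=
  Quot.mk _ t

theorem PresentedHom.cast_mk {O : Type u} [Monoid O] {G : O → O → Type v}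
    (R : ∀ {A B : O}, SMCTerm G A B → SMCTerm G A B → Prop) {A A' B B' : O} (hA : A = A')
    (hB : B = B') (t : SMCTerm G A B) :
    castHom (PresentedHom R) hA hB (PresentedHom.mk R t)
      = PresentedHom.mk R (castHom (SMCTerm G) hA hB t) := by
  subst hA; subst hB; rfl

/-- The strict SMC presented by the generators `G` and the relations `R`. -/
def presentedSMC {O : Type u} [Monoid O] {G : O → O → Type v}
    (R : ∀ {A B : O}, SMCTerm G A B → SMCTerm G A B → Prop) : StrictSMC.{u, max u v} O where
  Hom := PresentedHom R
  id A := PresentedHom.mk R (SMCTerm.id A)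
  comp := Quot.map₂ SMCTerm.comp
    (fun s _ _ h => SMCCongr.comp_congr (SMCCongr.refl s) h)
    (fun _ _ t h => SMCCongr.comp_congr h (SMCCongr.refl t))
  tensor := Quot.map₂ SMCTerm.tensor
    (fun s _ _ h => SMCCongr.tensor_congr (SMCCongr.refl s) h)
    (fun _ _ t h => SMCCongr.tensor_congr h (SMCCongr.refl t))
  swap A B := PresentedHom.mk R (SMCTerm.swap A B)
  id_comp := by rintro A B ⟨f⟩; exact Quot.sound (SMCCongr.id_comp f)
  comp_id := by rintro A B ⟨f⟩; exact Quot.sound (SMCCongr.comp_id f)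
  assoc := by rintro A B C D ⟨f⟩ ⟨g⟩ ⟨h⟩; exact Quot.sound (SMCCongr.assoc f g h)
  tensor_id A B := Quot.sound (SMCCongr.tensor_id A B)
  tensor_comp := by
    rintro A B C A' B' C' ⟨f⟩ ⟨g⟩ ⟨f'⟩ ⟨g'⟩; exact Quot.sound (SMCCongr.tensor_comp f g f' g')
  tensor_assoc := by
    rintro A B C A' B' C' ⟨f⟩ ⟨g⟩ ⟨h⟩
    exact (PresentedHom.cast_mk R _ _ _).trans (Quot.sound (SMCCongr.tensor_assoc f g h))
  unit_tensor := by
    rintro A B ⟨f⟩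
    exact (PresentedHom.cast_mk R _ _ _).trans (Quot.sound (SMCCongr.unit_tensor f))
  tensor_unit := by
    rintro A B ⟨f⟩
    exact (PresentedHom.cast_mk R _ _ _).trans (Quot.sound (SMCCongr.tensor_unit f))
  swap_natural := by
    rintro A B C D ⟨f⟩ ⟨g⟩; exact Quot.sound (SMCCongr.swap_natural f g)
  swap_unit A := (PresentedHom.cast_mk R _ _ _).trans (Quot.sound (SMCCongr.swap_unit A))
  swap_tensor A B C := by
    have h := PresentedHom.cast_mk R rfl (mul_assoc B A C)
      ((SMCTerm.swap A B).tensor (SMCTerm.id C))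
    refine (PresentedHom.cast_mk R _ _ _).trans
      ((Quot.sound (SMCCongr.swap_tensor A B C)).trans ?_)
    exact (congrArg (fun x => Quot.map₂ SMCTerm.comp
      (fun s _ _ h => SMCCongr.comp_congr (SMCCongr.refl s) h)
      (fun _ _ t h => SMCCongr.comp_congr h (SMCCongr.refl t)) x
      (PresentedHom.mk R ((SMCTerm.id B).tensor (SMCTerm.swap A C)))) h).symm
  swap_swap A B := Quot.sound (SMCCongr.swap_swap A B)

/-! ### The affine completion -/

/-- Generators of the affine completion: the morphisms of `C` and a discard map `!_A : A → I` for
each object. -/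
inductive AffineGen {O : Type u} [Monoid O] (C : StrictSMC.{u, v} O) : O → O → Type (max u v)
  | hom {A B : O} (f : C.Hom A B) : AffineGen C A B
  | discard (A : O) : AffineGen C A 1

/-- Relations of the affine completion: the equations of `C` hold, and `I` is terminal. The
latter contains `!_B ∘ f = !_A` for every `f : A → B`. -/
inductive AffineRel {O : Type u} [Monoid O] (C : StrictSMC.{u, v} O) :
    ∀ {A B : O}, SMCTerm (AffineGen C) A B → SMCTerm (AffineGen C) A B → Prop
  | hom_id (A : O) : AffineRel C (.gen (.hom (C.id A))) (.id A)
  | hom_comp {A B E : O} (f : C.Hom A B) (g : C.Hom B E) :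
      AffineRel C (.gen (.hom (C.comp f g))) (.comp (.gen (.hom f)) (.gen (.hom g)))
  | hom_tensor {A B A' B' : O} (f : C.Hom A B) (g : C.Hom A' B') :
      AffineRel C (.gen (.hom (C.tensor f g))) (.tensor (.gen (.hom f)) (.gen (.hom g)))
  | hom_swap (A B : O) : AffineRel C (.gen (.hom (C.swap A B))) (.swap A B)
  | terminal {A : O} (t : SMCTerm (AffineGen C) A 1) : AffineRel C t (.gen (.discard A))

/-- The affine completion `C^!`: the free strict SMC on `C` with terminal unit. -/
def affineCompletion {O : Type u} [Monoid O] (C : StrictSMC.{u, v} O) :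
    StrictSMC.{u, max u v} O :=
  presentedSMC (AffineRel C)

/-- The morphism `!_A : A → I` of `C^!`. -/
def affineDiscard {O : Type u} [Monoid O] (C : StrictSMC.{u, v} O) (A : O) :
    (affineCompletion C).Hom A 1 :=
  PresentedHom.mk (AffineRel C) (.gen (.discard A))

/-- The functor `C → C^!`. -/
def affineIncl {O : Type u} [Monoid O] (C : StrictSMC.{u, v} O) :
    IOOFunctor C (affineCompletion C) where
  map f := PresentedHom.mk (AffineRel C) (.gen (.hom f))
  map_id A := Quot.sound (.of (.hom_id A))
  map_comp f g := Quot.sound (.of (.hom_comp f g))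
  map_tensor f g := Quot.sound (.of (.hom_tensor f g))
  map_swap A B := Quot.sound (.of (.hom_swap A B))

/-! ### Pushouts of identity-on-objects functors -/

/-- Relations of the pushout of `F : B → C` and `G : B → D`: the equations of `C`, the equations
of `D`, and `F f = G f` for all morphisms `f` of `B`. -/
inductive PushoutRel {O : Type u} [Monoid O] {B : StrictSMC.{u, v} O} {C : StrictSMC.{u, v} O}
    {D : StrictSMC.{u, w} O} (F : IOOFunctor B C) (G : IOOFunctor B D) :
    ∀ {X Y : O}, SMCTerm (fun X Y => C.Hom X Y ⊕ D.Hom X Y) X Y →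
      SMCTerm (fun X Y => C.Hom X Y ⊕ D.Hom X Y) X Y → Prop
  | inl_id (X : O) : PushoutRel F G (.gen (.inl (C.id X))) (.id X)
  | inl_comp {X Y Z : O} (f : C.Hom X Y) (g : C.Hom Y Z) :
      PushoutRel F G (.gen (.inl (C.comp f g))) (.comp (.gen (.inl f)) (.gen (.inl g)))
  | inl_tensor {X Y X' Y' : O} (f : C.Hom X Y) (g : C.Hom X' Y') :
      PushoutRel F G (.gen (.inl (C.tensor f g))) (.tensor (.gen (.inl f)) (.gen (.inl g)))
  | inl_swap (X Y : O) : PushoutRel F G (.gen (.inl (C.swap X Y))) (.swap X Y)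
  | inr_id (X : O) : PushoutRel F G (.gen (.inr (D.id X))) (.id X)
  | inr_comp {X Y Z : O} (f : D.Hom X Y) (g : D.Hom Y Z) :
      PushoutRel F G (.gen (.inr (D.comp f g))) (.comp (.gen (.inr f)) (.gen (.inr g)))
  | inr_tensor {X Y X' Y' : O} (f : D.Hom X Y) (g : D.Hom X' Y') :
      PushoutRel F G (.gen (.inr (D.tensor f g))) (.tensor (.gen (.inr f)) (.gen (.inr g)))
  | inr_swap (X Y : O) : PushoutRel F G (.gen (.inr (D.swap X Y))) (.swap X Y)
  | glue {X Y : O} (f : B.Hom X Y) :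
      PushoutRel F G (.gen (.inl (F.map f))) (.gen (.inr (G.map f)))

/-- The pushout of strict SMCs along identity-on-objects functors. -/
def pushoutSMC {O : Type u} [Monoid O] {B : StrictSMC.{u, v} O} {C : StrictSMC.{u, v} O}
    {D : StrictSMC.{u, w} O} (F : IOOFunctor B C) (G : IOOFunctor B D) :
    StrictSMC.{u, max u v w} O :=
  presentedSMC (PushoutRel F G)

/-- The first coprojection of the pushout. -/
def pushoutInl {O : Type u} [Monoid O] {B : StrictSMC.{u, v} O} {C : StrictSMC.{u, v} O}
    {D : StrictSMC.{u, w} O} (F : IOOFunctor B C) (G : IOOFunctor B D) :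
    IOOFunctor C (pushoutSMC F G) where
  map f := PresentedHom.mk (PushoutRel F G) (.gen (.inl f))
  map_id A := Quot.sound (.of (.inl_id A))
  map_comp f g := Quot.sound (.of (.inl_comp f g))
  map_tensor f g := Quot.sound (.of (.inl_tensor f g))
  map_swap A B := Quot.sound (.of (.inl_swap A B))

/-- The second coprojection of the pushout. -/
def pushoutInr {O : Type u} [Monoid O] {B : StrictSMC.{u, v} O} {C : StrictSMC.{u, v} O}
    {D : StrictSMC.{u, w} O} (F : IOOFunctor B C) (G : IOOFunctor B D) :
    IOOFunctor D (pushoutSMC F G) where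
  map f := PresentedHom.mk (PushoutRel F G) (.gen (.inr f))
  map_id A := Quot.sound (.of (.inr_id A))
  map_comp f g := Quot.sound (.of (.inr_comp f g))
  map_tensor f g := Quot.sound (.of (.inr_tensor f g))
  map_swap A B := Quot.sound (.of (.inr_swap A B))

/-! ### Isometries, the discard construction, environment structures -/

namespace DaggerSMC

variable {O : Type u} [Monoid O]

/-- `f` is an isometry if `f† ∘ f = 1`. -/
def IsIsometry (C : DaggerSMC.{u, v} O) {A B : O} (f : C.Hom A B) : Prop :=
  C.comp f (C.dagger f) = C.id A

/-- The subcategory `C_iso` of isometries. -/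
def isoSMC (C : DaggerSMC.{u, v} O) : StrictSMC.{u, v} O where
  Hom A B := {f : C.Hom A B // C.IsIsometry f}
  id A := ⟨C.id A, by rw [IsIsometry, C.dagger_id, C.id_comp]⟩
  comp f g := ⟨C.comp f.1 g.1, by
    have hf : C.comp f.1 (C.dagger f.1) = C.id _ := f.2
    have hg : C.comp g.1 (C.dagger g.1) = C.id _ := g.2
    rw [IsIsometry, C.dagger_comp, C.assoc, ← C.assoc g.1, hg, C.id_comp, hf]⟩
  tensor f g := ⟨C.tensor f.1 g.1, by
    have hf : C.comp f.1 (C.dagger f.1) = C.id _ := f.2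
    have hg : C.comp g.1 (C.dagger g.1) = C.id _ := g.2
    rw [IsIsometry, C.dagger_tensor, ← C.tensor_comp, hf, hg, C.tensor_id]⟩
  swap A B := ⟨C.swap A B, by rw [IsIsometry, C.dagger_swap, C.swap_swap]⟩
  id_comp f := Subtype.ext (C.id_comp f.1)
  comp_id f := Subtype.ext (C.comp_id f.1)
  assoc f g h := Subtype.ext (C.assoc f.1 g.1 h.1)
  tensor_id A B := Subtype.ext (C.tensor_id A B)
  tensor_comp f g f' g' := Subtype.ext (C.tensor_comp f.1 g.1 f'.1 g'.1)
  tensor_assoc f g h := Subtype.ext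
    ((castHom_map (H := fun A B => {f : C.Hom A B // C.IsIsometry f}) (K := C.Hom)
      (fun x => x.1) _ _ _).trans (C.tensor_assoc f.1 g.1 h.1))
  unit_tensor f := Subtype.ext
    ((castHom_map (H := fun A B => {f : C.Hom A B // C.IsIsometry f}) (K := C.Hom)
      (fun x => x.1) _ _ _).trans (C.unit_tensor f.1))
  tensor_unit f := Subtype.ext
    ((castHom_map (H := fun A B => {f : C.Hom A B // C.IsIsometry f}) (K := C.Hom)
      (fun x => x.1) _ _ _).trans (C.tensor_unit f.1))
  swap_natural f g := Subtype.ext (C.swap_natural f.1 g.1)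
  swap_unit A := Subtype.ext
    ((castHom_map (H := fun A B => {f : C.Hom A B // C.IsIsometry f}) (K := C.Hom)
      (fun x => x.1) _ _ _).trans (C.swap_unit A))
  swap_tensor A B D := by
    apply Subtype.ext
    refine (castHom_map (H := fun A B => {f : C.Hom A B // C.IsIsometry f}) (K := C.Hom)
      (fun x => x.1) _ _ _).trans ?_
    refine (C.swap_tensor A B D).trans ?_
    have key : ∀ {X X' Y Y' : O} (hX : X = X') (hY : Y = Y') (f : C.Hom X Y)
        (hf : C.IsIsometry f), castHom C.Hom hX hY f =
          (castHom (fun A B => {f : C.Hom A B // C.IsIsometry f}) hX hY ⟨f, hf⟩).1 := by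
      intro X X' Y Y' hX hY f hf; subst hX; subst hY; rfl
    exact congrArg (fun x => C.comp x (C.tensor (C.id B) (C.swap A D))) (key _ _ _ _)
  swap_swap A B := Subtype.ext (C.swap_swap A B)

/-- The inclusion `C_iso → C`. -/
def isoIncl (C : DaggerSMC.{u, v} O) : IOOFunctor C.isoSMC C.toStrictSMC where
  map f := Subtype.val f
  map_id _ := rfl
  map_comp _ _ := rfl
  map_tensor _ _ := rfl
  map_swap _ _ := rfl

/-- The discard construction: the pushout of `C ← C_iso → (C_iso)^!`. -/
def discardSMC (C : DaggerSMC.{u, v} O) : StrictSMC.{u, max u v} O :=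
  pushoutSMC C.isoIncl (affineIncl C.isoSMC)

/-- The functor from `C` to its discard construction. -/
def discardIncl (C : DaggerSMC.{u, v} O) : IOOFunctor C.toStrictSMC C.discardSMC :=
  pushoutInl C.isoIncl (affineIncl C.isoSMC)

/-- The discard map on `A` in the discard construction: the image of `!_A`. -/
def ground (C : DaggerSMC.{u, v} O) (A : O) : C.discardSMC.Hom A 1 :=
  (pushoutInr C.isoIncl (affineIncl C.isoSMC)).map (affineDiscard C.isoSMC A)

/-- `†`-compact: every object has a dual with `cup† = σ ∘ cap`. -/
def IsDaggerCompact (C : DaggerSMC.{u, v} O) : Prop :=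
  ∀ A : O, ∃ (A' : O) (cup : C.Hom (A * A') 1) (cap : C.Hom 1 (A' * A)),
    C.IsDuality cup cap ∧ C.dagger cup = C.comp cap (C.swap A' A)

/-- Pairs `(X, f)` with `f : A → B ⊗ X`. -/
abbrev Dilation (C : DaggerSMC.{u, v} O) (A B : O) : Type (max u v) :=
  Σ X : O, C.Hom A (B * X)

/-- The composite `A ⊗ B → B ⊗ X ⊗ B → B ⊗ B ⊗ X → B ⊗ A` of `f ⊗ 1`, `1 ⊗ σ` and `1 ⊗ f†`:
`f` and `f†` are connected along `X`. -/
def doubled (C : DaggerSMC.{u, v} O) {A B : O} (f : C.Dilation A B) : C.Hom (A * B) (B * A) :=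
  C.comp
    (castHom C.Hom rfl (mul_assoc B f.1 B) (C.tensor f.2 (C.id B)))
    (C.comp (C.tensor (C.id B) (C.swap f.1 B)) (C.tensor (C.id B) (C.dagger f.2)))

/-- The relation `∼_CP`. -/
def SimCP (C : DaggerSMC.{u, v} O) {A B : O} (f g : C.Dilation A B) : Prop :=
  C.doubled f = C.doubled g

/-- The relation `∼_iso`: there are isometries `u : X → Z`, `v : Y → Z` with
`(1_B ⊗ u) ∘ f = (1_B ⊗ v) ∘ g`. -/
def SimIso (C : DaggerSMC.{u, v} O) {A B : O} (f g : C.Dilation A B) : Prop :=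
  ∃ (Z : O) (u : C.Hom f.1 Z) (v : C.Hom g.1 Z), C.IsIsometry u ∧ C.IsIsometry v ∧
    C.comp f.2 (C.tensor (C.id B) u) = C.comp g.2 (C.tensor (C.id B) v)

/-- `(1_B ⊗ ⏚_X) ∘ ι(f) : A → B`. -/
def discardAfter (C : DaggerSMC.{u, v} O) {D : StrictSMC.{u, w} O}
    (ι : IOOFunctor C.toStrictSMC D) (gr : ∀ A : O, D.Hom A 1) {A B : O} (f : C.Dilation A B) :
    D.Hom A B :=
  D.comp (ι.map f.2) (castHom D.Hom rfl (mul_one B) (D.tensor (D.id B) (gr f.1)))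

/-- `D`, with the functor `ι : C → D` and the discard maps `gr`, is an environment structure for
the `†`-compact category `C`. -/
structure IsEnvironmentStructure (C : DaggerSMC.{u, v} O) (D : StrictSMC.{u, w} O)
    (ι : IOOFunctor C.toStrictSMC D) (gr : ∀ A : O, D.Hom A 1) : Prop where
  base_daggerCompact : C.IsDaggerCompact
  compactClosed : D.IsCompactClosed
  ground_unit : gr 1 = D.id 1
  ground_tensor : ∀ A B : O,
    castHom D.Hom rfl (mul_one 1) (D.tensor (gr A) (gr B)) = gr (A * B)
  purification : ∀ {A B : O} (f : D.Hom A B),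
    ∃ f' : C.Dilation A B, f = C.discardAfter ι gr f'
  uniqueness : ∀ {A B : O} (f g : C.Dilation A B),
    C.SimCP f g ↔ C.discardAfter ι gr f = C.discardAfter ι gr g

end DaggerSMC

/-! ### Finite dimensional Hilbert spaces -/

/-- Hom-sets of `FHilb`: linear maps `ℂ^m → ℂ^n`, as matrices in the standard bases. -/
abbrev FHilbHom (m n : ℕ) : Type := Matrix (Fin n) (Fin m) ℂ

theorem FHilbHom.cast_apply {m m' n n' : ℕ} (hm : m = m') (hn : n = n') (f : FHilbHom m n)
    (i : Fin n') (j : Fin m') :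
    castHom FHilbHom hm hn f i j = f (Fin.cast hn.symm i) (Fin.cast hm.symm j) := by
  subst hm; subst hn; rfl

/-- The tensor product `ℂ^m ⊗ ℂ^n = ℂ^(mn)`: Kronecker product, with the lexicographic
identification `e_i ⊗ e_j = e_(n i + j)`. -/
def FHilbHom.tensor {m n m' n' : ℕ} (f : FHilbHom m n) (g : FHilbHom m' n') :
    FHilbHom (m * m') (n * n') :=
  Matrix.reindex finProdFinEquiv finProdFinEquiv (Matrix.kronecker f g)

/-- The symmetry `e_i ⊗ e_j ↦ e_j ⊗ e_i`. -/
def FHilbHom.swap (m n : ℕ) : FHilbHom (m * n) (n * m) :=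
  Matrix.reindex ((Equiv.prodComm (Fin m) (Fin n)).trans finProdFinEquiv) finProdFinEquiv
    (1 : Matrix (Fin m × Fin n) (Fin m × Fin n) ℂ)

theorem FHilbHom.tensor_apply {m n m' n' : ℕ} (f : FHilbHom m n) (g : FHilbHom m' n')
    (i : Fin n) (i' : Fin n') (j : Fin m) (j' : Fin m') :
    f.tensor g (finProdFinEquiv (i, i')) (finProdFinEquiv (j, j')) = f i j * g i' j' := by
  simp [FHilbHom.tensor]

theorem FHilbHom.swap_apply (m n : ℕ) (i : Fin n) (i' : Fin m) (j : Fin m) (j' : Fin n) :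
    FHilbHom.swap m n (finProdFinEquiv (i, i')) (finProdFinEquiv (j, j'))
      = if i' = j ∧ i = j' then 1 else 0 := by
  simp [FHilbHom.swap, Matrix.one_apply]

theorem FHilbHom.ext_prod {m n m' n' : ℕ} {f g : FHilbHom (m * m') (n * n')}
    (h : ∀ i i' j j', f (finProdFinEquiv (i, i')) (finProdFinEquiv (j, j'))
      = g (finProdFinEquiv (i, i')) (finProdFinEquiv (j, j'))) : f = g := by
  ext i j
  obtain ⟨⟨i, i'⟩, rfl⟩ := finProdFinEquiv.surjective i
  obtain ⟨⟨j, j'⟩, rfl⟩ := finProdFinEquiv.surjective j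
  exact h i i' j j'

theorem finProd_assoc {a b c : ℕ} (i : Fin a) (j : Fin b) (k : Fin c) :
    Fin.cast (mul_assoc a b c).symm (finProdFinEquiv (i, finProdFinEquiv (j, k)))
      = finProdFinEquiv (finProdFinEquiv (i, j), k) := by
  ext; simp [finProdFinEquiv]; ring

theorem finProd_assoc' {a b c : ℕ} (i : Fin a) (j : Fin b) (k : Fin c) :
    Fin.cast (mul_assoc a b c) (finProdFinEquiv (finProdFinEquiv (i, j), k))
      = finProdFinEquiv (i, finProdFinEquiv (j, k)) := by
  ext; simp [finProdFinEquiv]; ring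

theorem finProd_one {a : ℕ} (i : Fin a) :
    Fin.cast (mul_one a).symm i = finProdFinEquiv (i, (0 : Fin 1)) := by
  ext; simp [finProdFinEquiv]

theorem one_finProd {a : ℕ} (i : Fin a) :
    Fin.cast (one_mul a).symm i = finProdFinEquiv ((0 : Fin 1), i) := by
  ext; simp [finProdFinEquiv]

/-- `FHilb`: the objects are the spaces `ℂ^n`, given by `n : ℕ`, with tensor product
`ℂ^m ⊗ ℂ^n = ℂ^(mn)` and unit `ℂ`; the dagger is the adjoint. -/
noncomputable def FHilb : DaggerSMC.{0, 0} ℕ where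
  Hom := FHilbHom
  id n := (1 : Matrix (Fin n) (Fin n) ℂ)
  comp f g := g * f
  tensor f g := FHilbHom.tensor f g
  swap := FHilbHom.swap
  dagger f := f.conjTranspose
  id_comp f := Matrix.mul_one f
  comp_id f := Matrix.one_mul f
  assoc f g h := (Matrix.mul_assoc h g f).symm
  tensor_id A B := by
    apply FHilbHom.ext_prod
    intro i i' j j'
    rw [FHilbHom.tensor_apply]
    simp only [Matrix.one_apply, EmbeddingLike.apply_eq_iff_eq, Prod.mk.injEq, ite_and]
    split_ifs <;> simp
  tensor_comp f g f' g' := by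
    apply FHilbHom.ext_prod
    intro i i' j j'
    rw [FHilbHom.tensor_apply, Matrix.mul_apply, Matrix.mul_apply, Matrix.mul_apply,
      ← finProdFinEquiv.sum_comp, Fintype.sum_prod_type, Finset.sum_mul_sum]
    simp only [FHilbHom.tensor_apply]
    exact Finset.sum_congr rfl fun _ _ => Finset.sum_congr rfl fun _ _ => by ring
  tensor_assoc {A B C A' B' C'} f g h := by
    apply FHilbHom.ext_prod
    intro i i' j j'
    obtain ⟨⟨i', i''⟩, rfl⟩ := finProdFinEquiv.surjective i'
    obtain ⟨⟨j', j''⟩, rfl⟩ := finProdFinEquiv.surjective j'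
    rw [FHilbHom.cast_apply, finProd_assoc, finProd_assoc]
    simp only [FHilbHom.tensor_apply, mul_assoc]
  unit_tensor f := by
    ext i j
    rw [FHilbHom.cast_apply, one_finProd, one_finProd, FHilbHom.tensor_apply]
    simp
  tensor_unit f := by
    ext i j
    rw [FHilbHom.cast_apply, finProd_one, finProd_one, FHilbHom.tensor_apply]
    simp
  swap_natural f g := by
    apply FHilbHom.ext_prod
    intro i i' j j'
    rw [Matrix.mul_apply, Matrix.mul_apply, ← finProdFinEquiv.sum_comp,
      ← finProdFinEquiv.sum_comp, Fintype.sum_prod_type, Fintype.sum_prod_type]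
    simp only [FHilbHom.tensor_apply, FHilbHom.swap_apply]
    simp [ite_and, mul_comm]
  swap_unit A := by
    ext i j
    rw [FHilbHom.cast_apply, one_finProd, finProd_one, FHilbHom.swap_apply]
    simp [Matrix.one_apply]
  swap_tensor A B C := by
    ext x y
    obtain ⟨⟨b, x⟩, rfl⟩ := finProdFinEquiv.surjective x
    obtain ⟨⟨c, a⟩, rfl⟩ := finProdFinEquiv.surjective x
    obtain ⟨⟨y, c'⟩, rfl⟩ := finProdFinEquiv.surjective y
    obtain ⟨⟨a', b'⟩, rfl⟩ := finProdFinEquiv.surjective y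
    rw [FHilbHom.cast_apply, finProd_assoc, finProd_assoc', FHilbHom.swap_apply,
      Matrix.mul_apply, ← finProdFinEquiv.sum_comp, Fintype.sum_prod_type]
    rw [Finset.sum_congr rfl fun _ _ => (finProdFinEquiv.sum_comp _).symm]
    simp only [Fintype.sum_prod_type, FHilbHom.tensor_apply, FHilbHom.cast_apply,
      finProd_assoc, FHilbHom.swap_apply, Fin.cast_refl, id_eq]
    simp [Matrix.one_apply, ite_and]
    grind
  swap_swap A B := by
    apply FHilbHom.ext_prod
    intro i i' j j'
    rw [Matrix.mul_apply, ← finProdFinEquiv.sum_comp, Fintype.sum_prod_type]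
    simp only [FHilbHom.swap_apply]
    simp [Matrix.one_apply, ite_and]
    split_ifs <;> rfl
  dagger_dagger f := Matrix.conjTranspose_conjTranspose f
  dagger_id A := Matrix.conjTranspose_one
  dagger_comp f g := Matrix.conjTranspose_mul g f
  dagger_tensor f g := by
    apply FHilbHom.ext_prod
    intro i i' j j'
    rw [Matrix.conjTranspose_apply, FHilbHom.tensor_apply, FHilbHom.tensor_apply]
    simp
  dagger_swap A B := by
    apply FHilbHom.ext_prod
    intro i i' j j'
    rw [Matrix.conjTranspose_apply, FHilbHom.swap_apply, FHilbHom.swap_apply]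
    simp only [eq_comm, and_comm]
    split_ifs <;> simp

universe x

/-! The core is that three relations on dilations coincide: `SimCP`, `SimIso`, and equality in the
discard construction after discarding the environment. They are linked by a cycle of implications.

`SimIso` gives equality in the discard construction because an isometry lies in both halves of the
pushout; in the affine completion terminality of the unit absorbs it into the discard map
(`SimIso.discardAfter_eq`).

Equality in the discard construction gives `SimCP` by soundness of a model: send a linear map `f` to
`ρ ↦ fρf†` and discarding to the trace. Isometries preserve the trace, so the universal properties
yield a functor from the discard construction to linear maps between matrix algebras, and `ρ ↦
Tr_X(fρf†)` has the same entries as the doubled morphism (`FHilb_simCP_of_discardAfter_eq`).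

`SimCP` gives `SimIso` by uniqueness of Stinespring dilations: the relation says that two families
of Kraus operators have the same Gram matrix, so isometries into a common space identify them
(`FHilb_simIso_of_simCP`).

Transitivity of `SimIso` is then inherited from equality. Purification holds because morphisms with
a dilation contain all generators and are closed under composition and tensor; duals are transported
along the canonical functor. -/

theorem castHom_castHom {O : Type u} {H : O → O → Type v} {A A' A'' B B' B'' : O} (hA : A = A')
    (hB : B = B') (hA' : A' = A'') (hB' : B' = B'') (f : H A B) :
    castHom H hA' hB' (castHom H hA hB f) = castHom H (hA.trans hA') (hB.trans hB') f := by
  subst hA hB hA' hB'; rfl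

/-! ### Transport along object equalities and discarding of a tensor factor -/

namespace StrictSMC

variable {O : Type u} [Monoid O] (C : StrictSMC.{u, v} O)

theorem castHom_comp {A A' B B' E E' : O} (hA : A = A') (hB : B = B') (hE : E = E')
    (f : C.Hom A B) (g : C.Hom B E) :
    C.comp (castHom C.Hom hA hB f) (castHom C.Hom hB hE g) =
      castHom C.Hom hA hE (C.comp f g) := by
  subst hA hB hE; rfl

theorem castHom_comp_right {A B E E' : O} (hE : E = E') (f : C.Hom A B) (g : C.Hom B E) :
    C.comp f (castHom C.Hom rfl hE g) = castHom C.Hom rfl hE (C.comp f g) := by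
  subst hE; rfl

theorem comp_castHom_left {A B B' E : O} (hB : B' = B) (f : C.Hom A B) (g : C.Hom B' E) :
    C.comp f (castHom C.Hom hB rfl g) = C.comp (castHom C.Hom rfl hB.symm f) g := by
  subst hB; rfl

theorem castHom_tensor_left {A A' B B' E F : O} (hA : A = A') (hB : B = B')
    (f : C.Hom A B) (g : C.Hom E F) :
    C.tensor (castHom C.Hom hA hB f) g =
      castHom C.Hom (by rw [hA]) (by rw [hB]) (C.tensor f g) := by
  subst hA hB; rfl

theorem castHom_tensor_right {A A' B B' E F : O} (hA : A = A') (hB : B = B')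
    (f : C.Hom A B) (g : C.Hom E F) :
    C.tensor g (castHom C.Hom hA hB f) =
      castHom C.Hom (by rw [hA]) (by rw [hB]) (C.tensor g f) := by
  subst hA hB; rfl

/-- Discarding the second tensor factor. -/
def discardRight (gr : ∀ A : O, C.Hom A 1) (B X : O) : C.Hom (B * X) B :=
  castHom C.Hom rfl (mul_one B) (C.tensor (C.id B) (gr X))

variable {C} {gr : ∀ A : O, C.Hom A 1}

theorem tensor_id_comp_discardRight {A B X : O} (f : C.Hom A B) :
    C.comp (C.tensor f (C.id X)) (C.discardRight gr B X) =
      castHom C.Hom rfl (mul_one B) (C.tensor f (gr X)) := by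
  rw [discardRight, castHom_comp_right, ← C.tensor_comp, C.comp_id, C.id_comp]

/-- Interchange law: the two maps act on different tensor factors. This lets a discard be postponed
to the end of a composite. -/
theorem discardRight_comp {A B X : O} (f : C.Hom A B) :
    C.comp (C.discardRight gr A X) f =
      C.comp (C.tensor f (C.id X)) (C.discardRight gr B X) := by
  rw [tensor_id_comp_discardRight, discardRight]
  conv_lhs => rw [← C.tensor_unit f]
  rw [castHom_comp, ← C.tensor_comp, C.comp_id, C.id_comp]

/-- Multiplicativity of the discard maps merges two successive environments into one. -/
theorem discardRight_discardRight
    (hgr : ∀ A B : O, castHom C.Hom rfl (mul_one 1) (C.tensor (gr A) (gr B)) = gr (A * B))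
    (B X Y : O) :
    C.comp (C.discardRight gr (B * Y) X) (C.discardRight gr B Y) =
      castHom C.Hom (mul_assoc B Y X).symm rfl (C.discardRight gr B (Y * X)) := by
  rw [discardRight_comp, tensor_id_comp_discardRight, discardRight, discardRight,
    castHom_tensor_left, ← hgr, castHom_tensor_right, ← C.tensor_assoc]
  simp only [castHom_castHom]

theorem id_tensor_discardRight (A B X : O) :
    C.tensor (C.id A) (C.discardRight gr B X) =
      castHom C.Hom (mul_assoc A B X) rfl (C.discardRight gr (A * B) X) := by
  rw [discardRight, discardRight, castHom_tensor_right, ← C.tensor_assoc, C.tensor_id]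
  simp only [castHom_castHom]

/-- Conjugating by the symmetry reduces closure under tensor to closure under tensoring with an
identity on the left. -/
theorem tensor_eq_comp {A B A' B' : O} (f : C.Hom A B) (g : C.Hom A' B') :
    C.tensor f g = C.comp (C.comp (C.swap A A') (C.comp (C.tensor (C.id A') f) (C.swap A' B)))
      (C.tensor (C.id B) g) := by
  rw [C.swap_natural, ← C.assoc, C.swap_swap, C.id_comp, ← C.tensor_comp, C.comp_id, C.id_comp]

end StrictSMC

/-! ### Functors preserve duals -/

namespace IOOFunctor

variable {O : Type u} [Monoid O] {C : StrictSMC.{u, v} O} {D : StrictSMC.{u, w} O}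

theorem map_castHom (F : IOOFunctor C D) {A A' B B' : O} (hA : A = A') (hB : B = B')
    (f : C.Hom A B) : F.map (castHom C.Hom hA hB f) = castHom D.Hom hA hB (F.map f) :=
  castHom_map (H := C.Hom) (K := D.Hom) F.map hA hB f

theorem isDuality (F : IOOFunctor C D) {A A' : O} {cup : C.Hom (A * A') 1}
    {cap : C.Hom 1 (A' * A)} (h : C.IsDuality cup cap) :
    D.IsDuality (F.map cup) (F.map cap) := by
  constructor
  · simpa only [F.map_comp, F.map_castHom, F.map_tensor, F.map_id] using congrArg F.map h.1
  · simpa only [F.map_comp, F.map_castHom, F.map_tensor, F.map_id] using congrArg F.map h.2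

theorem isCompactClosed (F : IOOFunctor C D) (h : C.IsCompactClosed) : D.IsCompactClosed := by
  intro A
  obtain ⟨A', cup, cap, hd⟩ := h A
  exact ⟨A', _, _, F.isDuality hd⟩

end IOOFunctor

/-! ### Morphisms with a dilation are closed under composition and tensor -/

namespace DaggerSMC

variable {O : Type u} [Monoid O]

section Purification

variable (C : DaggerSMC.{u, v} O) {D : StrictSMC.{u, w} O}
  (ι : IOOFunctor C.toStrictSMC D) (gr : ∀ A : O, D.Hom A 1)

/-- `f` is obtained from a morphism of `C` by discarding part of its codomain. -/
def HasDilation {A B : O} (f : D.Hom A B) : Prop :=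
  ∃ f' : C.Dilation A B, f = C.discardAfter ι gr f'

variable {C ι gr}

theorem discardAfter_eq {A B : O} (f : C.Dilation A B) :
    C.discardAfter ι gr f = D.comp (ι.map f.2) (D.discardRight gr B f.1) := rfl

/-- The environment is the unit, whose discard map is the identity. -/
theorem hasDilation_map (h1 : gr 1 = D.id 1) {A B : O} (f : C.Hom A B) :
    C.HasDilation ι gr (ι.map f) := by
  refine ⟨⟨1, castHom C.Hom rfl (mul_one B).symm f⟩, ?_⟩
  rw [discardAfter_eq, StrictSMC.discardRight, h1, D.tensor_id, ι.map_castHom,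
    D.castHom_comp_right]
  dsimp only
  rw [D.comp_id, castHom_castHom]
  rfl

/-- The identity of `A` is a dilation whose environment is all of `A`. -/
theorem hasDilation_ground (A : O) : C.HasDilation ι gr (gr A) := by
  refine ⟨⟨A, castHom C.Hom rfl (one_mul A).symm (C.id A)⟩, ?_⟩
  have h : D.discardRight gr 1 A = castHom D.Hom (one_mul A).symm rfl (gr A) := by
    conv_rhs => rw [← D.unit_tensor (gr A)]
    rw [StrictSMC.discardRight, castHom_castHom]
  rw [discardAfter_eq, h, D.comp_castHom_left, ι.map_castHom, castHom_castHom, ι.map_id]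
  exact (D.id_comp _).symm

/-- The discard of `X` is pushed past `g'`, and the two environments are then merged into `Y * X`.
-/
theorem HasDilation.comp
    (hgr : ∀ A B : O, castHom D.Hom rfl (mul_one 1) (D.tensor (gr A) (gr B)) = gr (A * B))
    {A B E : O} {f : D.Hom A B} {g : D.Hom B E} (hf : C.HasDilation ι gr f)
    (hg : C.HasDilation ι gr g) : C.HasDilation ι gr (D.comp f g) := by
  obtain ⟨⟨X, f'⟩, rfl⟩ := hf
  obtain ⟨⟨Y, g'⟩, rfl⟩ := hg
  refine ⟨⟨Y * X, castHom C.Hom rfl (mul_assoc E Y X) (C.comp f' (C.tensor g' (C.id X)))⟩, ?_⟩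
  simp only [discardAfter_eq]
  rw [D.assoc, ← D.assoc (D.discardRight gr B X), StrictSMC.discardRight_comp, D.assoc,
    StrictSMC.discardRight_discardRight hgr, ι.map_castHom, ι.map_comp, ι.map_tensor, ι.map_id,
    ← D.assoc, D.comp_castHom_left]

theorem HasDilation.id_tensor {A B : O} {f : D.Hom A B} (hf : C.HasDilation ι gr f) (E : O) :
    C.HasDilation ι gr (D.tensor (D.id E) f) := by
  obtain ⟨⟨X, f'⟩, rfl⟩ := hf
  refine ⟨⟨X, castHom C.Hom rfl (mul_assoc E B X).symm (C.tensor (C.id E) f')⟩, ?_⟩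
  simp only [discardAfter_eq]
  conv_lhs => rw [← D.id_comp (D.id E)]
  rw [D.tensor_comp, StrictSMC.id_tensor_discardRight, ι.map_castHom, ι.map_tensor, ι.map_id,
    D.comp_castHom_left]

theorem HasDilation.tensor (h1 : gr 1 = D.id 1)
    (hgr : ∀ A B : O, castHom D.Hom rfl (mul_one 1) (D.tensor (gr A) (gr B)) = gr (A * B))
    {A B A' B' : O} {f : D.Hom A B} {g : D.Hom A' B'} (hf : C.HasDilation ι gr f)
    (hg : C.HasDilation ι gr g) : C.HasDilation ι gr (D.tensor f g) := by
  have hs (X Y : O) : C.HasDilation ι gr (D.swap X Y) := by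
    rw [← ι.map_swap]; exact hasDilation_map h1 _
  rw [StrictSMC.tensor_eq_comp]
  exact ((hs _ _).comp hgr ((hf.id_tensor _).comp hgr (hs _ _))).comp hgr (hg.id_tensor _)

end Purification

/-! ### Discard maps and purification in the discard construction -/

variable (C : DaggerSMC.{u, v} O)

theorem ground_one : C.ground 1 = C.discardSMC.id 1 := by
  have h : affineDiscard C.isoSMC 1 = (affineCompletion C.isoSMC).id 1 :=
    (Quot.sound (.of (.terminal _))).symm
  rw [ground, h]
  exact IOOFunctor.map_id _ _

/-- Terminality of the unit. The laws of the discard maps in the pushout are images of instances of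
this one. -/
theorem eq_affineDiscard (D : StrictSMC.{u, v} O) {A : O} (f : (affineCompletion D).Hom A 1) :
    f = affineDiscard D A := by
  obtain ⟨t⟩ := f
  exact Quot.sound (.of (.terminal t))

theorem ground_mul (A B : O) :
    castHom C.discardSMC.Hom rfl (mul_one 1) (C.discardSMC.tensor (C.ground A) (C.ground B)) =
      C.ground (A * B) := by
  rw [ground, ground, ground, ← eq_affineDiscard C.isoSMC (castHom _ rfl (mul_one 1)
    ((affineCompletion C.isoSMC).tensor (affineDiscard C.isoSMC A) (affineDiscard C.isoSMC B)))]
  rw [IOOFunctor.map_castHom, IOOFunctor.map_tensor]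
  rfl

theorem discardIncl_map_isometry {A B : O} (f : C.isoSMC.Hom A B) :
    C.discardIncl.map f.1 = (pushoutInr C.isoIncl (affineIncl C.isoSMC)).map
      ((affineIncl C.isoSMC).map f) :=
  Quot.sound (.of (.glue (F := C.isoIncl) (G := affineIncl C.isoSMC) f))

/-- The gluing relation moves the isometry into the affine completion, where terminality absorbs it.
-/
theorem isometry_comp_ground {A B : O} (f : C.Hom A B) (hf : C.IsIsometry f) :
    C.discardSMC.comp (C.discardIncl.map f) (C.ground B) = C.ground A := by
  rw [C.discardIncl_map_isometry ⟨f, hf⟩, ground, ground,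
    ← eq_affineDiscard C.isoSMC ((affineCompletion C.isoSMC).comp
    ((affineIncl C.isoSMC).map ⟨f, hf⟩) (affineDiscard C.isoSMC B)), IOOFunctor.map_comp]
  rfl

theorem hasDilation_swap (A B : O) :
    C.HasDilation C.discardIncl C.ground (C.discardSMC.swap A B) := by
  rw [← IOOFunctor.map_swap C.discardIncl]
  exact hasDilation_map C.ground_one _

theorem hasDilation_id (A : O) :
    C.HasDilation C.discardIncl C.ground (C.discardSMC.id A) := by
  rw [← IOOFunctor.map_id C.discardIncl]
  exact hasDilation_map C.ground_one _

/-- A generator of the pushout coming from the affine completion is itself a class of terms, so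
purification needs this inner induction as well. -/
theorem hasDilation_pushoutInr {A B : O} (t : SMCTerm (AffineGen C.isoSMC) A B) :
    C.HasDilation C.discardIncl C.ground
      ((pushoutInr C.isoIncl (affineIncl C.isoSMC)).map (PresentedHom.mk (AffineRel _) t)) := by
  induction t with
  | gen g =>
    cases g with
    | hom f =>
      have h := hasDilation_map (ι := C.discardIncl) C.ground_one f.1
      rw [C.discardIncl_map_isometry f] at h
      exact h
    | discard => exact hasDilation_ground (C := C) (ι := C.discardIncl) (gr := C.ground) _
  | id A =>
    rw [show PresentedHom.mk (AffineRel C.isoSMC) (.id A) = (affineCompletion C.isoSMC).id A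
      from rfl, IOOFunctor.map_id]
    exact C.hasDilation_id A
  | swap A B =>
    rw [show PresentedHom.mk (AffineRel C.isoSMC) (.swap A B) = (affineCompletion C.isoSMC).swap A B
      from rfl, IOOFunctor.map_swap]
    exact C.hasDilation_swap A B
  | comp s t hs ht =>
    refine (congrArg (C.HasDilation C.discardIncl C.ground) (IOOFunctor.map_comp
      (pushoutInr C.isoIncl (affineIncl C.isoSMC)) (PresentedHom.mk (AffineRel _) s)
      (PresentedHom.mk (AffineRel _) t))).mpr ?_
    exact HasDilation.comp C.ground_mul hs ht
  | tensor s t hs ht =>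
    refine (congrArg (C.HasDilation C.discardIncl C.ground) (IOOFunctor.map_tensor
      (pushoutInr C.isoIncl (affineIncl C.isoSMC)) (PresentedHom.mk (AffineRel _) s)
      (PresentedHom.mk (AffineRel _) t))).mpr ?_
    exact HasDilation.tensor C.ground_one C.ground_mul hs ht

theorem hasDilation {A B : O} (f : C.discardSMC.Hom A B) :
    C.HasDilation C.discardIncl C.ground f := by
  refine Quot.ind (fun t => ?_) f
  clear f
  induction t with
  | gen g =>
    obtain g | ⟨⟨t⟩⟩ := g
    · exact hasDilation_map (ι := C.discardIncl) C.ground_one g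
    · exact C.hasDilation_pushoutInr t
  | id A => exact C.hasDilation_id A
  | swap A B => exact C.hasDilation_swap A B
  | comp s t hs ht => exact HasDilation.comp C.ground_mul hs ht
  | tensor s t hs ht => exact HasDilation.tensor C.ground_one C.ground_mul hs ht

theorem SimIso.discardAfter_eq {C : DaggerSMC.{u, v} O} {A B : O} {f g : C.Dilation A B}
    (h : C.SimIso f g) : C.discardAfter C.discardIncl C.ground f =
      C.discardAfter C.discardIncl C.ground g := by
  obtain ⟨Z, u, v, hu, hv, h⟩ := h
  have key (f : C.Dilation A B) (u : C.Hom f.1 Z) (hu : C.IsIsometry u) :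
      C.discardAfter C.discardIncl C.ground f = C.discardSMC.comp
        (C.discardIncl.map (C.comp f.2 (C.tensor (C.id B) u)))
        (C.discardSMC.discardRight C.ground B Z) := by
    rw [DaggerSMC.discardAfter_eq, IOOFunctor.map_comp, IOOFunctor.map_tensor, IOOFunctor.map_id,
      StrictSMC.discardRight, StrictSMC.discardRight, StrictSMC.assoc,
      StrictSMC.castHom_comp_right, StrictSMC.castHom_comp_right, StrictSMC.castHom_comp_right,
      ← StrictSMC.tensor_comp, StrictSMC.id_comp,
      C.isometry_comp_ground u hu]
  rw [key f u hu, key g v hv, h]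

end DaggerSMC

/-! ### The universal property of presented strict SMCs -/

namespace SMCTerm

variable {O : Type u} [Monoid O] {G : O → O → Type v} (E : StrictSMC.{u, w} O)
  (φ : ∀ {A B : O}, G A B → E.Hom A B)

/-- Interpretation of formal composites in a strict SMC. -/
def eval : ∀ {A B : O}, SMCTerm G A B → E.Hom A B
  | _, _, .gen g => φ g
  | _, _, .id A => E.id A
  | _, _, .swap A B => E.swap A B
  | _, _, .comp s t => E.comp (eval s) (eval t)
  | _, _, .tensor s t => E.tensor (eval s) (eval t)

theorem eval_castHom {A A' B B' : O} (hA : A = A') (hB : B = B') (t : SMCTerm G A B) :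
    eval E φ (castHom (SMCTerm G) hA hB t) = castHom E.Hom hA hB (eval E φ t) :=
  castHom_map (H := SMCTerm G) (K := E.Hom) (eval E φ) hA hB t

variable {E φ}

/-- The target satisfies every law of strict SMCs, so having equal interpretations is a congruence
containing them. -/
theorem eval_eq_of_congr {R : ∀ {A B : O}, SMCTerm G A B → SMCTerm G A B → Prop}
    (hR : ∀ {A B : O} {s t : SMCTerm G A B}, R s t → eval E φ s = eval E φ t) {A B : O}
    {s t : SMCTerm G A B} (h : SMCCongr R s t) : eval E φ s = eval E φ t := by
  induction h with
  | of h => exact hR h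
  | refl => rfl
  | symm _ ih => exact ih.symm
  | trans _ _ ih₁ ih₂ => exact ih₁.trans ih₂
  | comp_congr _ _ ih₁ ih₂ => simp only [eval, ih₁, ih₂]
  | tensor_congr _ _ ih₁ ih₂ => simp only [eval, ih₁, ih₂]
  | id_comp f => exact E.id_comp _
  | comp_id f => exact E.comp_id _
  | assoc f g h => exact E.assoc _ _ _
  | tensor_id A B => exact E.tensor_id _ _
  | tensor_comp f g f' g' => exact E.tensor_comp _ _ _ _
  | tensor_assoc f g h => exact (eval_castHom E φ _ _ _).trans (E.tensor_assoc _ _ _)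
  | unit_tensor f => exact (eval_castHom E φ _ _ _).trans (E.unit_tensor _)
  | tensor_unit f => exact (eval_castHom E φ _ _ _).trans (E.tensor_unit _)
  | swap_natural f g => exact E.swap_natural _ _
  | swap_unit A => exact (eval_castHom E φ _ _ _).trans (E.swap_unit _)
  | swap_tensor A B C =>
    refine (eval_castHom E φ _ _ _).trans ((E.swap_tensor _ _ _).trans ?_)
    simp only [eval, eval_castHom]
  | swap_swap A B => exact E.swap_swap _ _

end SMCTerm

/-- The functor out of a presented strict SMC given by an interpretation of the generators that
satisfies the relations. -/
def presentedLift {O : Type u} [Monoid O] {G : O → O → Type v}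
    {R : ∀ {A B : O}, SMCTerm G A B → SMCTerm G A B → Prop} (E : StrictSMC.{u, w} O)
    (φ : ∀ {A B : O}, G A B → E.Hom A B)
    (hR : ∀ {A B : O} {s t : SMCTerm G A B}, R s t → s.eval E φ = t.eval E φ) :
    IOOFunctor (presentedSMC R) E where
  map := Quot.lift (SMCTerm.eval E φ) fun _ _ h => SMCTerm.eval_eq_of_congr hR h
  map_id _ := rfl
  map_comp := by rintro A B C ⟨f⟩ ⟨g⟩; rfl
  map_tensor := by rintro A B A' B' ⟨f⟩ ⟨g⟩; rfl
  map_swap _ _ := rfl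

/-- The functor out of a pushout given by a commutative square. -/
def pushoutLift {O : Type u} [Monoid O] {B C : StrictSMC.{u, v} O} {D : StrictSMC.{u, w} O}
    {F : IOOFunctor B C} {G : IOOFunctor B D} {E : StrictSMC.{u, x} O} (P : IOOFunctor C E)
    (Q : IOOFunctor D E) (h : ∀ {X Y : O} (f : B.Hom X Y), P.map (F.map f) = Q.map (G.map f)) :
    IOOFunctor (pushoutSMC F G) E :=
  presentedLift E (fun f => Sum.elim P.map Q.map f) <| by
    intro X Y s t hst
    cases hst with
    | inl_id => exact P.map_id _
    | inl_comp => exact P.map_comp _ _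
    | inl_tensor => exact P.map_tensor _ _
    | inl_swap => exact P.map_swap _ _
    | inr_id => exact Q.map_id _
    | inr_comp => exact Q.map_comp _ _
    | inr_tensor => exact Q.map_tensor _ _
    | inr_swap => exact Q.map_swap _ _
    | glue f => exact h f

/-! ### Functors out of the affine completion and the discard construction -/

section AffineLift

variable {O : Type u} [Monoid O] {C : StrictSMC.{u, v} O} {E : StrictSMC.{u, w} O}
  (P : IOOFunctor C E) (tr : ∀ A : O, E.Hom A 1)

/-- The interpretation of the generators of an affine completion. -/
def AffineGen.interpret : ∀ {A B : O}, AffineGen C A B → E.Hom A B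
  | _, _, .hom f => P.map f
  | _, _, .discard A => tr A

variable {P tr}

/-- Every interpreted term preserves discarding. An arbitrary codomain is needed for the induction;
codomain `1` gives the terminality relation. -/
theorem AffineGen.eval_comp (h1 : tr 1 = E.id 1)
    (htr : ∀ A B : O, castHom E.Hom rfl (mul_one 1) (E.tensor (tr A) (tr B)) = tr (A * B))
    (hP : ∀ {A B : O} (f : C.Hom A B), E.comp (P.map f) (tr B) = tr A) {A B : O}
    (t : SMCTerm (AffineGen C) A B) :
    E.comp (t.eval E (AffineGen.interpret P tr)) (tr B) = tr A := by
  induction t with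
  | gen g =>
    cases g with
    | hom f => exact hP f
    | discard => rw [h1]; exact E.comp_id _
  | id A => exact E.id_comp _
  | swap A B =>
    have := hP (C.swap A B)
    rwa [P.map_swap] at this
  | comp s t hs ht => rw [SMCTerm.eval, E.assoc, ht, hs]
  | tensor s t hs ht =>
    rw [SMCTerm.eval, ← htr, E.castHom_comp_right, ← E.tensor_comp, hs, ht, htr]

/-- The functor out of an affine completion given by a functor that preserves discard maps. -/
def affineLift (P : IOOFunctor C E) (tr : ∀ A : O, E.Hom A 1) (h1 : tr 1 = E.id 1)
    (htr : ∀ A B : O, castHom E.Hom rfl (mul_one 1) (E.tensor (tr A) (tr B)) = tr (A * B))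
    (hP : ∀ {A B : O} (f : C.Hom A B), E.comp (P.map f) (tr B) = tr A) :
    IOOFunctor (affineCompletion C) E :=
  presentedLift E (AffineGen.interpret P tr) <| by
    intro X Y s t hst
    cases hst with
    | hom_id => exact P.map_id _
    | hom_comp => exact P.map_comp _ _
    | hom_tensor => exact P.map_tensor _ _
    | hom_swap => exact P.map_swap _ _
    | terminal t =>
      have := AffineGen.eval_comp h1 htr hP t
      rw [h1, E.comp_id] at this
      exact this

end AffineLift

namespace DaggerSMC

variable {O : Type u} [Monoid O] {C : DaggerSMC.{u, v} O} {E : StrictSMC.{u, v} O}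

/-- A functor that turns discarding after isometries into discarding identifies dilations that
become equal in the discard construction. -/
theorem discardAfter_eq_of_discardIncl (P : IOOFunctor C.toStrictSMC E) (tr : ∀ A : O, E.Hom A 1)
    (h1 : tr 1 = E.id 1)
    (htr : ∀ A B : O, castHom E.Hom rfl (mul_one 1) (E.tensor (tr A) (tr B)) = tr (A * B))
    (hP : ∀ {A B : O} (f : C.Hom A B), C.IsIsometry f → E.comp (P.map f) (tr B) = tr A)
    {A B : O} {f g : C.Dilation A B}
    (h : C.discardAfter C.discardIncl C.ground f = C.discardAfter C.discardIncl C.ground g) :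
    C.discardAfter P tr f = C.discardAfter P tr g := by
  -- Only isometries are assumed to preserve discarding, so the affine lift starts from the
  -- restriction of `P` to them.
  let P' : IOOFunctor C.isoSMC E :=
    { map := fun f => P.map f.1
      map_id := P.map_id
      map_comp := fun f g => P.map_comp f.1 g.1
      map_tensor := fun f g => P.map_tensor f.1 g.1
      map_swap := P.map_swap }
  let Q : IOOFunctor C.discardSMC E := pushoutLift (F := C.isoIncl) (G := affineIncl C.isoSMC) P
    (affineLift P' tr h1 htr fun f => hP f.1 f.2) fun f => rfl
  have key (f : C.Dilation A B) :
      Q.map (C.discardAfter C.discardIncl C.ground f) = C.discardAfter P tr f := by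
    rw [discardAfter, Q.map_comp, Q.map_castHom, Q.map_tensor, Q.map_id]
    rfl
  rw [← key, ← key, h]

end DaggerSMC
-- The model: linear maps between matrix algebras
open Matrix

/-- The identification of pairs of indices of `ℂ^m ⊗ ℂ^n` with pairs of pairs of indices. -/
def pairProdEquiv (m n : ℕ) :
    (Fin m × Fin m) × (Fin n × Fin n) ≃ Fin (m * n) × Fin (m * n) :=
  (Equiv.prodProdProdComm _ _ _ _).trans (Equiv.prodCongr finProdFinEquiv finProdFinEquiv)

/-- Linear maps between full matrix algebras, as matrices in the bases of matrix units. -/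
abbrev SuperHom (m n : ℕ) : Type := Matrix (Fin n × Fin n) (Fin m × Fin m) ℂ

namespace SuperHom

theorem cast_apply {m m' n n' : ℕ} (hm : m = m') (hn : n = n') (f : SuperHom m n)
    (i : Fin n' × Fin n') (j : Fin m' × Fin m') :
    castHom SuperHom hm hn f i j = f (i.map (Fin.cast hn.symm) (Fin.cast hn.symm))
      (j.map (Fin.cast hm.symm) (Fin.cast hm.symm)) := by
  subst hm; subst hn; rfl

/-- The tensor product of linear maps between matrix algebras. -/
def tensor {m n m' n' : ℕ} (f : SuperHom m n) (g : SuperHom m' n') :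
    SuperHom (m * m') (n * n') :=
  Matrix.reindex (pairProdEquiv n n') (pairProdEquiv m m') (Matrix.kronecker f g)

theorem tensor_apply {m n m' n' : ℕ} (f : SuperHom m n) (g : SuperHom m' n')
    (i : Fin n × Fin n) (i' : Fin n' × Fin n') (j : Fin m × Fin m) (j' : Fin m' × Fin m') :
    f.tensor g (pairProdEquiv n n' (i, i')) (pairProdEquiv m m' (j, j')) = f i j * g i' j' := by
  simp [tensor]

theorem ext_prod {m n m' n' : ℕ} {f g : SuperHom (m * m') (n * n')}
    (h : ∀ i i' j j', f (pairProdEquiv n n' (i, i')) (pairProdEquiv m m' (j, j'))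
      = g (pairProdEquiv n n' (i, i')) (pairProdEquiv m m' (j, j'))) : f = g := by
  ext i j
  obtain ⟨⟨i, i'⟩, rfl⟩ := (pairProdEquiv _ _).surjective i
  obtain ⟨⟨j, j'⟩, rfl⟩ := (pairProdEquiv _ _).surjective j
  exact h i i' j j'

theorem tensor_mul {a b c a' b' c' : ℕ} (f : SuperHom a b) (g : SuperHom b c)
    (f' : SuperHom a' b') (g' : SuperHom b' c') :
    tensor (g * f) (g' * f') = tensor g g' * tensor f f' := by
  rw [tensor, tensor, tensor, Matrix.kronecker, Matrix.mul_kronecker_mul]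
  simp [Matrix.submatrix_mul_equiv]

theorem pairProd_assoc {a b c : ℕ} (i : Fin a × Fin a) (j : Fin b × Fin b) (k : Fin c × Fin c) :
    (pairProdEquiv a (b * c) (i, pairProdEquiv b c (j, k))).map
      (Fin.cast (mul_assoc a b c).symm) (Fin.cast (mul_assoc a b c).symm) =
      pairProdEquiv (a * b) c (pairProdEquiv a b (i, j), k) :=
  Prod.ext (finProd_assoc _ _ _) (finProd_assoc _ _ _)

theorem pairProd_one {a : ℕ} (i : Fin a × Fin a) :
    i.map (Fin.cast (mul_one a).symm) (Fin.cast (mul_one a).symm) =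
      pairProdEquiv a 1 (i, (0, 0)) :=
  Prod.ext (finProd_one _) (finProd_one _)

theorem one_pairProd {a : ℕ} (i : Fin a × Fin a) :
    i.map (Fin.cast (one_mul a).symm) (Fin.cast (one_mul a).symm) =
      pairProdEquiv 1 a ((0, 0), i) :=
  Prod.ext (one_finProd _) (one_finProd _)

/-- Conjugation `ρ ↦ f ρ f†` by a linear map. -/
def conj {m n : ℕ} (f : FHilbHom m n) : SuperHom m n := Matrix.kronecker f (f.map star)

theorem conj_apply {m n : ℕ} (f : FHilbHom m n) (i : Fin n × Fin n) (j : Fin m × Fin m) :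
    conj f i j = f i.1 j.1 * star (f i.2 j.2) := rfl

theorem conj_one (n : ℕ) : conj (1 : FHilbHom n n) = 1 := by
  simp [conj, Matrix.map_one]

theorem conj_mul {a b c : ℕ} (f : FHilbHom a b) (g : FHilbHom b c) :
    conj (g * f : FHilbHom a c) = conj g * conj f := by
  have : (g * f).map star = g.map star * f.map star := by
    ext i j; simp [Matrix.mul_apply]
  rw [conj, conj, conj, this]
  exact Matrix.mul_kronecker_mul _ _ _ _

theorem conj_tensor {m n m' n' : ℕ} (f : FHilbHom m n) (g : FHilbHom m' n') :
    conj (f.tensor g) = (conj f).tensor (conj g) := by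
  apply ext_prod
  intro i i' j j'
  rw [tensor_apply]
  simp only [conj_apply]
  have h1 := FHilbHom.tensor_apply f g i.1 i'.1 j.1 j'.1
  have h2 := FHilbHom.tensor_apply f g i.2 i'.2 j.2 j'.2
  change f.tensor g (finProdFinEquiv (i.1, i'.1)) (finProdFinEquiv (j.1, j'.1)) *
    star (f.tensor g (finProdFinEquiv (i.2, i'.2)) (finProdFinEquiv (j.2, j'.2))) = _
  rw [h1, h2, star_mul']
  ring

theorem castHom_conj {a b a' b' : ℕ} (ha : a = a') (hb : b = b') (f : FHilbHom a b) :
    castHom SuperHom ha hb (conj f) = conj (castHom FHilbHom ha hb f) := by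
  subst ha hb; rfl

/-- The symmetry permutes row and column indices alike, so it acts as the plain symmetry on pairs of
indices. -/
theorem conj_swap_apply (m n : ℕ) (i : Fin n × Fin n) (i' j : Fin m × Fin m)
    (j' : Fin n × Fin n) :
    conj (FHilbHom.swap m n) (pairProdEquiv n m (i, i')) (pairProdEquiv m n (j, j'))
      = if i' = j ∧ i = j' then 1 else 0 := by
  change FHilbHom.swap m n (finProdFinEquiv (i.1, i'.1)) (finProdFinEquiv (j.1, j'.1)) *
    star (FHilbHom.swap m n (finProdFinEquiv (i.2, i'.2)) (finProdFinEquiv (j.2, j'.2))) = _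
  rw [FHilbHom.swap_apply, FHilbHom.swap_apply]
  obtain ⟨i1, i2⟩ := i
  obtain ⟨i1', i2'⟩ := i'
  obtain ⟨j1, j2⟩ := j
  obtain ⟨j1', j2'⟩ := j'
  simp only [Prod.mk.injEq]
  split_ifs <;> first | (exfalso; grind) | simp

end SuperHom

/-- The strict SMC of the matrix algebras `M_n(ℂ)` and all linear maps. -/
noncomputable def superSMC : StrictSMC.{0, 0} ℕ where
  Hom := SuperHom
  id n := (1 : Matrix (Fin n × Fin n) (Fin n × Fin n) ℂ)
  comp f g := g * f
  tensor f g := SuperHom.tensor f g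
  swap m n := SuperHom.conj (FHilbHom.swap m n)
  id_comp f := Matrix.mul_one f
  comp_id f := Matrix.one_mul f
  assoc f g h := (Matrix.mul_assoc h g f).symm
  tensor_id A B := by
    rw [← SuperHom.conj_one, ← SuperHom.conj_one, ← SuperHom.conj_tensor, ← SuperHom.conj_one]
    exact congrArg SuperHom.conj (FHilb.tensor_id A B)
  tensor_comp f g f' g' := SuperHom.tensor_mul f g f' g'
  tensor_assoc {A B C A' B' C'} f g h := by
    apply SuperHom.ext_prod
    intro i i' j j'
    obtain ⟨⟨i', i''⟩, rfl⟩ := (pairProdEquiv _ _).surjective i'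
    obtain ⟨⟨j', j''⟩, rfl⟩ := (pairProdEquiv _ _).surjective j'
    rw [SuperHom.cast_apply, SuperHom.pairProd_assoc, SuperHom.pairProd_assoc]
    simp only [SuperHom.tensor_apply, mul_assoc]
  unit_tensor f := by
    ext i j
    rw [SuperHom.cast_apply, SuperHom.one_pairProd, SuperHom.one_pairProd, SuperHom.tensor_apply]
    simp
  tensor_unit f := by
    ext i j
    rw [SuperHom.cast_apply, SuperHom.pairProd_one, SuperHom.pairProd_one, SuperHom.tensor_apply]
    simp
  -- The other symmetry laws are images under `conj` of those of `FHilb`; naturality concerns all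
  -- linear maps, not just conjugations, and is checked on entries.
  swap_natural f g := by
    apply SuperHom.ext_prod
    intro i i' j j'
    rw [Matrix.mul_apply, Matrix.mul_apply, ← (pairProdEquiv _ _).sum_comp,
      ← (pairProdEquiv _ _).sum_comp, Finset.sum_eq_single (i', i), Finset.sum_eq_single (j', j)]
    · simp only [SuperHom.tensor_apply, SuperHom.conj_swap_apply]
      simp [mul_comm]
    · rintro ⟨y, y'⟩ _ hy
      rw [SuperHom.conj_swap_apply, if_neg (by rintro ⟨rfl, rfl⟩; exact hy rfl), mul_zero]
    · simp
    · rintro ⟨y, y'⟩ _ hy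
      rw [SuperHom.conj_swap_apply, if_neg (by rintro ⟨rfl, rfl⟩; exact hy rfl), zero_mul]
    · simp
  swap_unit A := by
    rw [SuperHom.castHom_conj, ← SuperHom.conj_one]
    exact congrArg SuperHom.conj (FHilb.swap_unit A)
  swap_tensor A B C := by
    rw [← SuperHom.conj_one, ← SuperHom.conj_one, ← SuperHom.conj_tensor, ← SuperHom.conj_tensor,
      SuperHom.castHom_conj, SuperHom.castHom_conj, ← SuperHom.conj_mul]
    exact congrArg SuperHom.conj (FHilb.swap_tensor A B C)
  swap_swap A B := by
    rw [← SuperHom.conj_mul, ← SuperHom.conj_one]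
    exact congrArg SuperHom.conj (FHilb.swap_swap A B)

/-- The functor that sends a linear map to conjugation by it. -/
noncomputable def conjFunctor : IOOFunctor FHilb.toStrictSMC superSMC where
  map := SuperHom.conj
  map_id A := SuperHom.conj_one A
  map_comp f g := SuperHom.conj_mul f g
  map_tensor f g := SuperHom.conj_tensor f g
  map_swap _ _ := rfl

/-! ### The trace and soundness of the model -/

namespace SuperHom

/-- The trace, as a linear map `M_n(ℂ) → M_1(ℂ)`. -/
def trace (n : ℕ) : SuperHom n 1 := Matrix.of fun _ j => if j.1 = j.2 then 1 else 0

theorem trace_apply (n : ℕ) (i : Fin 1 × Fin 1) (j : Fin n × Fin n) :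
    trace n i j = if j.1 = j.2 then 1 else 0 := rfl

theorem trace_one : trace 1 = 1 := by
  ext i j
  rw [trace_apply, if_pos (Subsingleton.elim _ _), Subsingleton.elim i j, Matrix.one_apply_eq]

theorem trace_tensor (A B : ℕ) :
    castHom SuperHom rfl (mul_one 1) (tensor (trace A) (trace B)) = trace (A * B) := by
  ext i j
  obtain ⟨⟨j, j'⟩, rfl⟩ := (pairProdEquiv _ _).surjective j
  have hj : ∀ x : Fin (A * B) × Fin (A * B), x.map (Fin.cast rfl) (Fin.cast rfl) = x :=
    fun x => rfl
  rw [cast_apply, pairProd_one, hj, tensor_apply]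
  simp only [trace_apply]
  simp [pairProdEquiv, ← ite_and, and_comm]

/-- Cyclicity: `tr(fρf†) = tr(f†fρ) = tr ρ`. -/
theorem trace_conj {A B : ℕ} (f : FHilbHom A B) (hf : fᴴ * f = 1) :
    trace B * conj f = trace A := by
  ext i ⟨j, k⟩
  have h := congrFun (congrFun hf k) j
  rw [Matrix.mul_apply] at h
  rw [Matrix.mul_apply, Fintype.sum_prod_type]
  simp only [trace_apply, conj_apply]
  simp only [Matrix.conjTranspose_apply, Matrix.one_apply] at h
  simp [mul_comm] at h ⊢
  rw [h]
  simp only [eq_comm]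

/-- This is the `(b, b')` entry of `Tr_X(fρf†)` at the matrix unit `ρ = e_a e_{a'}†`. -/
theorem partialTrace_conj_apply {A B X : ℕ} (f : FHilbHom A (B * X)) (b b' : Fin B)
    (a a' : Fin A) :
    (castHom SuperHom rfl (mul_one B) (tensor (1 : SuperHom B B) (trace X)) * conj f)
      (b, b') (a, a') =
      ∑ x, f (finProdFinEquiv (b, x)) a * star (f (finProdFinEquiv (b', x)) a') := by
  have hc : ∀ x : Fin (B * X) × Fin (B * X), x.map (Fin.cast rfl) (Fin.cast rfl) = x :=
    fun x => rfl
  rw [Matrix.mul_apply, ← (pairProdEquiv _ _).sum_comp, Fintype.sum_prod_type]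
  simp only [cast_apply, pairProd_one, hc, tensor_apply, Matrix.one_apply, conj_apply,
    trace_apply]
  rw [Finset.sum_eq_single (b, b')]
  · rw [Fintype.sum_prod_type]
    simp [pairProdEquiv]
  · intro y _ hy
    simp [hy.symm]
  · simp

end SuperHom

/-- The doubled morphism is a reshuffling of the matrix of `ρ ↦ Tr_X(fρf†)`: the sum is that of
`partialTrace_conj_apply`, with `a'` and `b'` exchanged between rows and columns. -/
theorem FHilbHom.doubled_apply {A B X : ℕ} (f : FHilbHom A (B * X)) (b b' : Fin B)
    (a a' : Fin A) :
    (FHilbHom.tensor (1 : FHilbHom B B) fᴴ * FHilbHom.tensor (1 : FHilbHom B B)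
      (FHilbHom.swap X B) * castHom FHilbHom rfl (mul_assoc B X B)
        (FHilbHom.tensor f (1 : FHilbHom B B))) (finProdFinEquiv (b, a')) (finProdFinEquiv (a, b'))
      = ∑ x, f (finProdFinEquiv (b, x)) a * star (f (finProdFinEquiv (b', x)) a') := by
  have hT : FHilbHom.tensor (1 : FHilbHom B B) fᴴ * FHilbHom.tensor (1 : FHilbHom B B)
      (FHilbHom.swap X B) = FHilbHom.tensor (1 : FHilbHom B B) (fᴴ * FHilbHom.swap X B) := by
    have h := FHilb.tensor_comp (FHilb.id B) (FHilb.id B) (FHilbHom.swap X B) fᴴ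
    rw [FHilb.id_comp] at h
    exact h.symm
  have hs (x : Fin X) (y : Fin B) : (fᴴ * FHilbHom.swap X B) a' (finProdFinEquiv (x, y)) =
      star (f (finProdFinEquiv (y, x)) a') := by
    rw [Matrix.mul_apply, ← finProdFinEquiv.sum_comp, Finset.sum_eq_single (y, x)]
    · simp [FHilbHom.swap_apply]
    · rintro ⟨y', x'⟩ _ hy
      rw [FHilbHom.swap_apply, if_neg (by rintro ⟨rfl, rfl⟩; exact hy rfl), mul_zero]
    · simp
  have hc : ∀ x : Fin (A * B), Fin.cast rfl x = x := fun x => rfl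
  rw [hT, Matrix.mul_apply, ← finProdFinEquiv.sum_comp, Fintype.sum_prod_type,
    Finset.sum_eq_single b]
  · rw [← finProdFinEquiv.sum_comp, Fintype.sum_prod_type]
    refine Finset.sum_congr rfl fun x _ => ?_
    rw [Finset.sum_eq_single b']
    · rw [FHilbHom.cast_apply, finProd_assoc, hc, FHilbHom.tensor_apply, FHilbHom.tensor_apply, hs]
      simp [mul_comm]
    · intro y _ hy
      rw [FHilbHom.cast_apply, finProd_assoc, hc, FHilbHom.tensor_apply, FHilbHom.tensor_apply]
      simp [hy]
    · simp
  · intro y _ hy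
    refine Finset.sum_eq_zero fun x _ => ?_
    rw [FHilbHom.tensor_apply]
    simp [hy.symm]
  · simp

/-- The trace, as a morphism `A → I`. -/
noncomputable def superTrace (n : ℕ) : superSMC.Hom n 1 := SuperHom.trace n

theorem FHilb_simCP_iff {A B X Y : ℕ} (f : FHilbHom A (B * X)) (g : FHilbHom A (B * Y)) :
    FHilb.SimCP (A := A) (B := B) ⟨X, f⟩ ⟨Y, g⟩ ↔ ∀ b b' a a',
      ∑ x, f (finProdFinEquiv (b, x)) a * star (f (finProdFinEquiv (b', x)) a') =
      ∑ y, g (finProdFinEquiv (b, y)) a * star (g (finProdFinEquiv (b', y)) a') := by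
  constructor
  · intro h b b' a a'
    exact (FHilbHom.doubled_apply f b b' a a').symm.trans
      ((congrFun (congrFun h _) _).trans (FHilbHom.doubled_apply g b b' a a'))
  · intro h
    apply FHilbHom.ext_prod
    intro b a' a b'
    exact (FHilbHom.doubled_apply f b b' a a').trans
      ((h b b' a a').trans (FHilbHom.doubled_apply g b b' a a').symm)

theorem FHilb_simCP_of_discardAfter_eq {A B : ℕ} {f g : FHilb.Dilation A B}
    (h : FHilb.discardAfter FHilb.discardIncl FHilb.ground f =
      FHilb.discardAfter FHilb.discardIncl FHilb.ground g) : FHilb.SimCP f g := by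
  have h' := DaggerSMC.discardAfter_eq_of_discardIncl conjFunctor superTrace SuperHom.trace_one
    SuperHom.trace_tensor (fun f hf => SuperHom.trace_conj f hf) h
  refine (FHilb_simCP_iff _ _).2 fun b b' a a' => ?_
  exact (SuperHom.partialTrace_conj_apply f.2 b b' a a').symm.trans
    ((congrFun (congrFun h' _) _).trans (SuperHom.partialTrace_conj_apply g.2 b b' a a'))

/-! ### Equal Gram matrices and uniqueness of dilations -/

/-- Two linear maps into a finite-dimensional inner product space with equal norms differ by an
isometry of the target. -/
theorem LinearIsometry.exists_comp_eq_of_norm_eq {𝕜 V W : Type*} [RCLike 𝕜] [AddCommGroup V]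
    [Module 𝕜 V] [NormedAddCommGroup W] [InnerProductSpace 𝕜 W] [FiniteDimensional 𝕜 W]
    (S T : V →ₗ[𝕜] W) (h : ∀ x, ‖S x‖ = ‖T x‖) : ∃ U : W →ₗᵢ[𝕜] W, ∀ x, U (S x) = T x := by
  obtain ⟨s, hs⟩ := S.rangeRestrict.exists_rightInverse_of_surjective S.range_rangeRestrict
  have hs' (y : LinearMap.range S) : S (s y) = y :=
    congrArg Subtype.val (LinearMap.congr_fun hs y)
  -- The map `S x ↦ T x`, written with a linear section `s` of `S`. The choice of `s` is immaterial,
  -- since equality of norms forces `S` and `T` to have the same kernel.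
  let L : LinearMap.range S →ₗᵢ[𝕜] W := ⟨T ∘ₗ s, fun y => by
    rw [LinearMap.comp_apply, ← h, hs']; rfl⟩
  refine ⟨L.extend, fun x => ?_⟩
  have hx := L.extend_apply ⟨S x, x, rfl⟩
  refine hx.trans ?_
  change T (s _) = T x
  -- The vector `s (S x) - x` is killed by `S`, hence by `T`.
  rw [← sub_eq_zero, ← map_sub, ← norm_eq_zero, ← h, map_sub, hs', sub_self, norm_zero]

/-- Matrices with the same Gram matrix differ by an isometry. -/
theorem Matrix.exists_isometry_mul_eq {m n : Type*} [Fintype m] [DecidableEq m] [Fintype n]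
    [DecidableEq n] (F G : Matrix m n ℂ) (h : Fᴴ * F = Gᴴ * G) :
    ∃ U : Matrix m m ℂ, Uᴴ * U = 1 ∧ U * F = G := by
  -- The squared norm of `F x` is the quadratic form of the Gram matrix, so it depends on `Fᴴ * F`
  -- alone.
  have hn (F : Matrix m n ℂ) (x : EuclideanSpace ℂ n) : ((‖F.toEuclideanLin x‖ ^ 2 : ℝ) : ℂ) =
      star (WithLp.ofLp x) ⬝ᵥ (Fᴴ * F) *ᵥ (WithLp.ofLp x) := by
    have := inner_self_eq_norm_sq_to_K (𝕜 := ℂ) (F.toEuclideanLin x)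
    push_cast
    refine this.symm.trans ?_
    rw [EuclideanSpace.inner_eq_star_dotProduct, Matrix.ofLp_toLpLin, Matrix.toLin'_apply,
      dotProduct_comm, Matrix.star_mulVec, ← Matrix.dotProduct_mulVec, Matrix.mulVec_mulVec]
  have hnorm (x : EuclideanSpace ℂ n) : ‖F.toEuclideanLin x‖ = ‖G.toEuclideanLin x‖ := by
    have := (hn F x).trans ((h ▸ rfl : _ = _).trans (hn G x).symm)
    exact (sq_eq_sq₀ (norm_nonneg _) (norm_nonneg _)).1 (Complex.ofReal_injective this)
  obtain ⟨U, hU⟩ := LinearIsometry.exists_comp_eq_of_norm_eq _ _ hnorm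
  let M : Matrix m m ℂ := Matrix.toEuclideanLin.symm U.toLinearMap
  have hM : M.toEuclideanLin = U.toLinearMap := LinearEquiv.apply_symm_apply _ _
  refine ⟨M, ?_, ?_⟩
  · apply Matrix.toEuclideanLin.injective
    refine LinearMap.ext fun x => ext_inner_left ℂ fun y => ?_
    rw [Matrix.toLpLin_mul_same, Matrix.toEuclideanLin_conjTranspose_eq_adjoint, hM,
      LinearMap.comp_apply, LinearMap.adjoint_inner_right, Matrix.toLpLin_one]
    exact U.inner_map_map y x
  · apply Matrix.toEuclideanLin.injective
    refine LinearMap.ext fun x => ?_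
    rw [Matrix.toLpLin_mul_same, hM]
    exact hU x

/-- Embedding both row spaces in `ℂ^(X+Y)` as complementary coordinate blocks keeps the Gram
matrices and reduces to the square case. -/
theorem Matrix.exists_isometries_mul_eq {X Y : ℕ} {n : Type*} [Fintype n] [DecidableEq n]
    (F : Matrix (Fin X) n ℂ) (G : Matrix (Fin Y) n ℂ) (h : Fᴴ * F = Gᴴ * G) :
    ∃ (Z : ℕ) (u : Matrix (Fin Z) (Fin X) ℂ) (v : Matrix (Fin Z) (Fin Y) ℂ),
      uᴴ * u = 1 ∧ vᴴ * v = 1 ∧ u * F = v * G := by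
  let u₀ : Matrix (Fin (X + Y)) (Fin X) ℂ :=
    (1 : Matrix (Fin (X + Y)) (Fin (X + Y)) ℂ).submatrix id (Fin.castAdd Y)
  let v₀ : Matrix (Fin (X + Y)) (Fin Y) ℂ :=
    (1 : Matrix (Fin (X + Y)) (Fin (X + Y)) ℂ).submatrix id (Fin.natAdd X)
  have hu : u₀ᴴ * u₀ = 1 := by
    ext i j
    simp [u₀, Matrix.mul_apply, Matrix.one_apply]
  have hv : v₀ᴴ * v₀ = 1 := by
    ext i j
    simp [v₀, Matrix.mul_apply, Matrix.one_apply]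
  obtain ⟨U, hU, hUF⟩ := Matrix.exists_isometry_mul_eq (u₀ * F) (v₀ * G) (by
    rw [Matrix.conjTranspose_mul, Matrix.conjTranspose_mul, Matrix.mul_assoc, Matrix.mul_assoc,
      ← Matrix.mul_assoc u₀ᴴ, ← Matrix.mul_assoc v₀ᴴ, hu, hv, Matrix.one_mul, Matrix.one_mul, h])
  refine ⟨X + Y, U * u₀, v₀, ?_, hv, by rw [Matrix.mul_assoc, hUF]⟩
  rw [Matrix.conjTranspose_mul, Matrix.mul_assoc, ← Matrix.mul_assoc Uᴴ, hU, Matrix.one_mul, hu]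

theorem FHilb_simIso_of_simCP {A B : ℕ} {f g : FHilb.Dilation A B} (h : FHilb.SimCP f g) :
    FHilb.SimIso f g := by
  obtain ⟨X, f⟩ := f
  obtain ⟨Y, g⟩ := g
  change FHilbHom A (B * X) at f
  change FHilbHom A (B * Y) at g
  have h := (FHilb_simCP_iff f g).1 h
  -- Row `x` is the Kraus operator `f(·, x)` flattened to a vector; `SimCP` is exactly equality of
  -- the Gram matrices of `F` and `G`.
  let F : Matrix (Fin X) (Fin B × Fin A) ℂ :=
    Matrix.of fun x p => f (finProdFinEquiv (p.1, x)) p.2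
  let G : Matrix (Fin Y) (Fin B × Fin A) ℂ :=
    Matrix.of fun x p => g (finProdFinEquiv (p.1, x)) p.2
  obtain ⟨Z, u, v, hu, hv, huv⟩ := Matrix.exists_isometries_mul_eq F G (by
    ext ⟨b', a'⟩ ⟨b, a⟩
    rw [Matrix.mul_apply, Matrix.mul_apply]
    simp only [Matrix.conjTranspose_apply, Matrix.of_apply, F, G]
    simpa only [mul_comm] using h b b' a a')
  refine ⟨Z, u, v, hu, hv, ?_⟩
  -- Acting by `u` on the environment is left multiplication of the flattened matrix by `u`.
  have key {X : ℕ} (f : FHilbHom A (B * X)) (u : FHilbHom X Z) (b : Fin B) (z : Fin Z)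
      (a : Fin A) : (FHilbHom.tensor (1 : FHilbHom B B) u * f) (finProdFinEquiv (b, z)) a =
      ∑ x, u z x * f (finProdFinEquiv (b, x)) a := by
    rw [Matrix.mul_apply, ← finProdFinEquiv.sum_comp, Fintype.sum_prod_type,
      Finset.sum_eq_single b]
    · simp [FHilbHom.tensor_apply]
    · intro y _ hy
      simp [FHilbHom.tensor_apply, hy.symm]
    · simp
  change FHilbHom.tensor (1 : FHilbHom B B) u * f = FHilbHom.tensor (1 : FHilbHom B B) v * g
  ext i a
  obtain ⟨⟨b, z⟩, rfl⟩ := finProdFinEquiv.surjective i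
  rw [key, key]
  exact congrFun (congrFun huv z) (b, a)

/-! ### Compact structure and the main theorem -/

theorem FHilb_isDaggerCompact : FHilb.IsDaggerCompact := by
  intro A
  -- Each space is its own dual through the standard basis: `e_j ⊗ e_k ↦ δ_jk`. This form is real
  -- and symmetric, which gives the dagger condition.
  let cup : FHilbHom (A * A) 1 := fun _ j =>
    if (finProdFinEquiv.symm j).1 = (finProdFinEquiv.symm j).2 then 1 else 0
  let cap : FHilbHom 1 (A * A) := cupᴴ
  have hcup (i : Fin 1) (j k : Fin A) :
      cup i (finProdFinEquiv (j, k)) = if j = k then 1 else 0 := by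
    simp only [cup, Equiv.symm_apply_apply]
  have hcap (i : Fin 1) (j k : Fin A) :
      cap (finProdFinEquiv (j, k)) i = if j = k then 1 else 0 := by
    simp only [cap, Matrix.conjTranspose_apply, hcup]
    split_ifs <;> simp
  have hc (m : ℕ) : ∀ x : Fin m, Fin.cast rfl x = x := fun x => rfl
  refine ⟨A, cup, cap, ⟨?_, ?_⟩, ?_⟩
  · change castHom FHilbHom rfl (one_mul A) (FHilbHom.tensor cup (1 : FHilbHom A A)) *
      castHom FHilbHom (mul_one A) (mul_assoc A A A).symm
        (FHilbHom.tensor (1 : FHilbHom A A) cap) = (1 : FHilbHom A A)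
    ext i j
    rw [Matrix.mul_apply, ← finProdFinEquiv.sum_comp, Fintype.sum_prod_type]
    rw [← finProdFinEquiv.sum_comp, Fintype.sum_prod_type]
    simp only [FHilbHom.cast_apply, one_finProd, finProd_one, hc, finProd_assoc',
      FHilbHom.tensor_apply, hcup, hcap, Matrix.one_apply]
    simp [eq_comm]
  · change castHom FHilbHom rfl (mul_one A) (FHilbHom.tensor (1 : FHilbHom A A) cup) *
      castHom FHilbHom (one_mul A) (mul_assoc A A A)
        (FHilbHom.tensor cap (1 : FHilbHom A A)) = (1 : FHilbHom A A)
    ext i j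
    rw [Matrix.mul_apply, ← finProdFinEquiv.sum_comp, Fintype.sum_prod_type]
    rw [Finset.sum_congr rfl fun _ _ => (finProdFinEquiv.sum_comp _).symm]
    simp only [Fintype.sum_prod_type, FHilbHom.cast_apply, one_finProd, finProd_one, hc,
      finProd_assoc, FHilbHom.tensor_apply, hcup, hcap, Matrix.one_apply]
    simp [eq_comm]
  · change cupᴴ = FHilbHom.swap A A * cap
    ext i j
    obtain ⟨⟨i, i'⟩, rfl⟩ := finProdFinEquiv.surjective i
    rw [Matrix.mul_apply, ← finProdFinEquiv.sum_comp, Finset.sum_eq_single (i', i)]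
    · rw [FHilbHom.swap_apply, hcap, if_pos ⟨rfl, rfl⟩, one_mul]
      exact (hcap j i i').trans (by simp only [eq_comm])
    · rintro ⟨y', x'⟩ _ hy
      rw [FHilbHom.swap_apply, if_neg (by rintro ⟨rfl, rfl⟩; exact hy rfl), zero_mul]
    · simp

theorem mainTheorem5 :
    FHilb.IsEnvironmentStructure FHilb.discardSMC FHilb.discardIncl FHilb.ground ∧
    ∀ A B : ℕ,
      (∀ f g h : FHilb.Dilation A B, FHilb.SimIso f g → FHilb.SimIso g h → FHilb.SimIso f h) ∧
      (∀ f g : FHilb.Dilation A B, Relation.TransGen FHilb.SimIso f g ↔ FHilb.SimIso f g) := by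
  -- One turn of the cycle: equality in the discard construction is transitive, and it implies
  -- `SimCP`, hence `SimIso`.
  have htrans {A B : ℕ} (f g h : FHilb.Dilation A B) (hfg : FHilb.SimIso f g)
      (hgh : FHilb.SimIso g h) : FHilb.SimIso f h :=
    FHilb_simIso_of_simCP (FHilb_simCP_of_discardAfter_eq (hfg.discardAfter_eq.trans hgh.discardAfter_eq))
  refine ⟨⟨FHilb_isDaggerCompact, FHilb.discardIncl.isCompactClosed fun A => ?_, FHilb.ground_one,
    FHilb.ground_mul, FHilb.hasDilation, fun f g => ⟨fun h => (FHilb_simIso_of_simCP h).discardAfter_eq,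
      FHilb_simCP_of_discardAfter_eq⟩⟩, fun A B => ⟨htrans, fun f g => ⟨fun h => ?_, .single⟩⟩⟩
  · obtain ⟨A', cup, cap, h, -⟩ := FHilb_isDaggerCompact A
    exact ⟨A', cup, cap, h⟩
  · induction h with
    | single h => exact h
    | tail _ h ih => exact htrans _ _ _ ih h
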